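/- **Setting.** Let $\mathcal O\subset\mathbb R^3$ be a bounded open set (for example a bounded domain with smooth boundary), let $T,\mu_0,\mu_1>0$, and put $X:=H^1_0(\mathcal O;\mathbb R^3)\cap H^2(\mathcal O;\mathbb R^3)$, with the $H^2$-norm. Assume: * (A1) $u_0\in X$, $\nabla\cdot u_0=0$; * (A2) $\varphi\in X$, $\nabla\cdot\varphi=0$; * (A3) $\alpha^{-1}:=\int_{\mathcal O}\varphi\cdot\Delta u_0\,dx\neq0$; * (A4) $p_0\in H^1(\mathcal O)$, and $v_0:=(I-\mu_1\Delta)^{-1}\big(\mu_0\Delta u_0-(u_0\cdot\nabla)u_0-\nabla p_0\big)$ satisfies $\nabla\cdot v_0=0$; here $(I-\mu_1\Delta)^{-1}f$ is the weak solution $v\in H^1_0(\mathcal O;\mathbb R^3)$ of $v-\mu_1\Delta v=f$; * (A5) $r\in H^2(0,T)$, $r(0)=\int_{\mathcal O}(I-\mu_1\Delta)\varphi\cdot u_0\,dx$ and $r'(0)=\int_{\mathcal O}\big(\mu_0\Delta u_0-(u_0\cdot\nabla)u_0\big)\cdot\varphi\,dx$. **Inverse problem (I).** For $u\in H^2(0,T;X)$,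 $k\in L^2(0,T)$ and a pressure $p\in L^2(0,T;H^1(\mathcal O))$: $$\partial_tu-\mu_1\partial_t\Delta u-\mu_0\Delta u+(u\cdot\nabla)u-\int_0^tk(t-s)\Delta u(s)\,ds+\nabla p=0,\qquad \nabla\cdot u=0\qquad\text{a.e. in }\mathcal O\times(0,T),$$ $$u(0)=u_0,\qquad \int_{\mathcal O}(I-\mu_1\Delta)\varphi\cdot u(t)\,dx=r(t)\quad\text{for a.e. }t\in(0,T).$$ **Differentiated problem (D).** For $v\in H^1(0,T;X)$, $k\in L^2(0,T)$ and $p\in L^2(0,T;H^1(\mathcal O))$, with $u(t):=u_0+\int_0^tv(s)\,ds$: $$\partial_tv-\mu_1\partial_t\Delta v-\mu_0\Delta v-k\Delta u_0-\int_0^tk(t-s)\Delta v(s)\,ds+(v\cdot\nabla)u+(u\cdot\nabla)v+\nabla\partial_tp=0$$ in the sense of distributions on $\mathcal O\times(0,T)$, $\nabla\cdot v=0$ a.e. in $\mathcal O\times(0,T)$, $v(0)=v_0$, and, for a.e. $t\in(0,T)$, $$k(t)=\alpha\Big\{r''(t)-\mu_0\int_{\mathcal O}v\cdot\Delta\varphi\,dx-\int_0^tk(t-s)\int_{\mathcal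 O}v(s)\cdot\Delta\varphi\,dx\,ds-\int_{\mathcal O}\big((v\cdot\nabla)\varphi\big)\cdot u\,dx-\int_{\mathcal O}\big((u\cdot\nabla)\varphi\big)\cdot v\,dx\Big\}.$$ In both problems the boundary condition $u=0$, respectively $v=0$, on $\partial\mathcal O$ is contained in the values being in $H^1_0$. The condition $p(\cdot,0)=p_0$ is understood up to an additive constant: for every test field $\psi\in C_c^\infty(\mathcal O;\mathbb R^3)$ the function $t\mapsto\int_{\mathcal O}\nabla p(t)\cdot\psi\,dx$ has a representative that is continuous on $[0,T]$ with value $\int_{\mathcal O}\nabla p_0\cdot\psi\,dx$ at $0$. **Theorem.** Assume (A1)–(A5). 1. If $u\in H^2(0,T;X)$, $k\in L^2(0,T)$ and $(u,k)$ solves (I) with pressure $p$, then $v:=\partial_tu\in H^1(0,T;X)$, the pair $(v,k)$ solves (D) with the same pressure $p$, moreover $p(\cdot,0)=p_0$, and $u(t)=u_0+\int_0^tv(s)\,ds$ for a.e. $t$. 2. Conversely, if $v\in H^1(0,T;X)$, $k\in L^2(0,T)$ and $(v,k)$ solves (D) with a pressure $p$ satisfying $p(\cdot,0)=p_0$, then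 $u(t):=u_0+\int_0^tv(s)\,ds$ belongs to $H^2(0,T;X)$, $\partial_tu=v$, and $(u,k)$ solves (I) with the same pressure $p$. **Oseen case.** Let $u_\infty\in X$ with $\nabla\cdot u_\infty=0$. The same two assertions hold if in (A4), (A5) the term $(u_0\cdot\nabla)u_0$ is replaced by $(u_\infty\cdot\nabla)u_0$, in (I) the term $(u\cdot\nabla)u$ is replaced by $(u_\infty\cdot\nabla)u$, in (D) the sum $(v\cdot\nabla)u+(u\cdot\nabla)v$ is replaced by $(u_\infty\cdot\nabla)v$, and in the equation for $k$ the last two integrals are replaced by the single integral $\int_{\mathcal O}\big((u_\infty\cdot\nabla)\varphi\big)\cdot v\,dx$. -/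

import Mathlib

open MeasureTheory Set
open scoped ContDiff

noncomputable section

namespace KelvinVoigt

/-- Physical space `ℝ³` with the Euclidean norm. -/
abbrev E3 : Type := EuclideanSpace ℝ (Fin 3)

/-- The standard basis vectors of `ℝ³`. -/
abbrev basisVec (i : Fin 3) : E3 := EuclideanSpace.single i (1 : ℝ)

/-- `L²(O; F)` for a set `O ⊆ ℝ³`. -/
abbrev L2 (O : Set E3) (F : Type*) [NormedAddCommGroup F] : Type _ :=
  Lp F 2 ((volume : Measure E3).restrict O)

/-- Test functions on an open set `O`: smooth functions with compact support contained in `O`. -/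
structure IsTestFunction {V F : Type*} [NormedAddCommGroup V] [NormedSpace ℝ V]
    [NormedAddCommGroup F] [NormedSpace ℝ F] (O : Set V) (ψ : V → F) : Prop where
  smooth : ContDiff ℝ ∞ ψ
  compact_support : HasCompactSupport ψ
  support_subset : tsupport ψ ⊆ O

section Space

variable {F : Type*} [NormedAddCommGroup F] [NormedSpace ℝ F]

/-- `g` is the weak derivative (the matrix of all first order weak partial derivatives, seen as a
function with values in linear maps) of `f` on `O`:
`∫_O (∂_w ψ) f dx = - ∫_O ψ (g w) dx` for all scalar test functions `ψ` and all directions `w`. -/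
def IsWeakFDeriv (O : Set E3) (f : E3 → F) (g : E3 → E3 →L[ℝ] F) : Prop :=
  ∀ ψ : E3 → ℝ, IsTestFunction O ψ → ∀ w : E3,
    ∫ x in O, (fderiv ℝ ψ x w) • f x = - ∫ x in O, ψ x • g x w

theorem IsTestFunction.memLp {G : Type*} [NormedAddCommGroup G] [NormedSpace ℝ G]
    {O : Set E3} {ψ : E3 → G} (h : IsTestFunction O ψ) :
    MemLp ψ 2 ((volume : Measure E3).restrict O) :=
  (h.smooth.continuous.memLp_of_hasCompactSupport h.compact_support).restrict O

theorem IsTestFunction.memLp_fderiv {G : Type*} [NormedAddCommGroup G] [NormedSpace ℝ G]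
    {O : Set E3} {ψ : E3 → G} (h : IsTestFunction O ψ) :
    MemLp (fderiv ℝ ψ) 2 ((volume : Measure E3).restrict O) :=
  ((h.smooth.continuous_fderiv (by simp)).memLp_of_hasCompactSupport
    (h.compact_support.fderiv ℝ)).restrict O

theorem IsTestFunction.memLp_fderiv_apply {O : Set E3} {ψ : E3 → ℝ} (h : IsTestFunction O ψ)
    (w : E3) : MemLp (fun x => fderiv ℝ ψ x w) 2 ((volume : Measure E3).restrict O) :=
  (ContinuousLinearMap.apply ℝ ℝ w).comp_memLp' h.memLp_fderiv

/-- The pairs `(f, g) ∈ L² × L²` such that `g` is the weak derivative of `f`. -/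
def weakGraph (O : Set E3) (F : Type*) [NormedAddCommGroup F] [NormedSpace ℝ F] :
    Submodule ℝ (L2 O F × L2 O (E3 →L[ℝ] F)) where
  carrier := {q | IsWeakFDeriv O q.1 q.2}
  add_mem' := by
    intro a b ha hb ψ hψ w
    have e1 : ∀ f : L2 O F, Integrable (fun x => (fderiv ℝ ψ x w) • f x)
        ((volume : Measure E3).restrict O) := fun f =>
      memLp_one_iff_integrable.1 ((Lp.memLp f).smul (hψ.memLp_fderiv_apply w))
    have e2 : ∀ g : L2 O (E3 →L[ℝ] F), Integrable (fun x => ψ x • g x w)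
        ((volume : Measure E3).restrict O) := fun g =>
      memLp_one_iff_integrable.1
        (((ContinuousLinearMap.apply ℝ F w).comp_memLp' (Lp.memLp g)).smul hψ.memLp)
    have h1 : ∫ x in O, (fderiv ℝ ψ x w) • (a + b).1 x
        = ∫ x in O, ((fderiv ℝ ψ x w) • a.1 x + (fderiv ℝ ψ x w) • b.1 x) := by
      apply integral_congr_ae
      filter_upwards [Lp.coeFn_add a.1 b.1] with x hx
      rw [Prod.fst_add, hx, Pi.add_apply, smul_add]
    have h2 : ∫ x in O, ψ x • (a + b).2 x w
        = ∫ x in O, (ψ x • a.2 x w + ψ x • b.2 x w) := by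
      apply integral_congr_ae
      filter_upwards [Lp.coeFn_add a.2 b.2] with x hx
      rw [Prod.snd_add, hx, Pi.add_apply, _root_.add_apply, smul_add]
    rw [h1, h2, integral_add (e1 _) (e1 _), integral_add (e2 _) (e2 _), ha ψ hψ w, hb ψ hψ w]
    abel
  zero_mem' := by
    intro ψ hψ w
    have h1 : ∫ x in O, (fderiv ℝ ψ x w) • (0 : L2 O F × L2 O (E3 →L[ℝ] F)).1 x = 0 := by
      rw [← integral_zero E3 F]
      apply integral_congr_ae
      filter_upwards [Lp.coeFn_zero F 2 ((volume : Measure E3).restrict O)] with x hx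
      rw [Prod.fst_zero, hx, Pi.zero_apply, smul_zero]
    have h2 : ∫ x in O, ψ x • (0 : L2 O F × L2 O (E3 →L[ℝ] F)).2 x w = 0 := by
      rw [← integral_zero E3 F]
      apply integral_congr_ae
      filter_upwards [Lp.coeFn_zero (E3 →L[ℝ] F) 2 ((volume : Measure E3).restrict O)] with x hx
      rw [Prod.snd_zero, hx, Pi.zero_apply, _root_.zero_apply, smul_zero]
    rw [h1, h2, neg_zero]
  smul_mem' := by
    intro c a ha ψ hψ w
    have h1 : ∫ x in O, (fderiv ℝ ψ x w) • (c • a).1 x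
        = ∫ x in O, c • ((fderiv ℝ ψ x w) • a.1 x) := by
      apply integral_congr_ae
      filter_upwards [Lp.coeFn_smul c a.1] with x hx
      rw [Prod.smul_fst, hx, Pi.smul_apply, smul_comm]
    have h2 : ∫ x in O, ψ x • (c • a).2 x w = ∫ x in O, c • (ψ x • a.2 x w) := by
      apply integral_congr_ae
      filter_upwards [Lp.coeFn_smul c a.2] with x hx
      rw [Prod.smul_snd, hx, Pi.smul_apply, _root_.smul_apply, smul_comm]
    rw [h1, h2, integral_smul, integral_smul, ha ψ hψ w, smul_neg]

/-- The Sobolev space `H¹(O; F)`: an element is a pair `(f, ∇f)`. -/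
abbrev H1 (O : Set E3) (F : Type*) [NormedAddCommGroup F] [NormedSpace ℝ F] : Type _ :=
  weakGraph O F

/-- The pairs `(ψ, ∇ψ)` with `ψ` a test function on `O`. -/
def testGraph (O : Set E3) (F : Type*) [NormedAddCommGroup F] [NormedSpace ℝ F] :
    Submodule ℝ (L2 O F × L2 O (E3 →L[ℝ] F)) where
  carrier := {q | ∃ ψ : E3 → F, IsTestFunction O ψ ∧
    q.1 =ᵐ[volume.restrict O] ψ ∧ q.2 =ᵐ[volume.restrict O] fderiv ℝ ψ}
  add_mem' := by
    rintro a b ⟨ψ, hψ, h1, h2⟩ ⟨χ, hχ, k1, k2⟩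
    refine ⟨ψ + χ, ⟨hψ.smooth.add hχ.smooth, hψ.compact_support.add hχ.compact_support,
      (tsupport_add ψ χ).trans (union_subset hψ.support_subset hχ.support_subset)⟩, ?_, ?_⟩
    · exact (Lp.coeFn_add a.1 b.1).trans (h1.add k1)
    · refine ((Lp.coeFn_add a.2 b.2).trans (h2.add k2)).trans (Filter.Eventually.of_forall ?_)
      intro x
      exact (fderiv_add (hψ.smooth.differentiable (by simp) x)
        (hχ.smooth.differentiable (by simp) x)).symm
  zero_mem' := by
    refine ⟨0, ⟨contDiff_const, HasCompactSupport.zero, ?_⟩, Lp.coeFn_zero _ _ _, ?_⟩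
    · rw [tsupport_zero]
      exact empty_subset O
    · refine (Lp.coeFn_zero _ _ _).trans (Filter.Eventually.of_forall ?_)
      intro x
      simp
  smul_mem' := by
    rintro c a ⟨ψ, hψ, h1, h2⟩
    refine ⟨c • ψ, ⟨hψ.smooth.const_smul c, hψ.compact_support.smul_left (f := fun _ => c),
      (tsupport_smul_subset_right (fun _ => c) ψ).trans hψ.support_subset⟩, ?_, ?_⟩
    · exact (Lp.coeFn_smul c a.1).trans (h1.const_smul c)
    · refine ((Lp.coeFn_smul c a.2).trans (h2.const_smul c)).trans
        (Filter.Eventually.of_forall ?_)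
      intro x
      exact (fderiv_const_smul (hψ.smooth.differentiable (by simp) x) c).symm

/-- The Sobolev space `H¹₀(O; F)`: the closure of the test functions in the `H¹`-norm. An element
is a pair `(f, ∇f)`. -/
abbrev H10 (O : Set E3) (F : Type*) [NormedAddCommGroup F] [NormedSpace ℝ F] : Type _ :=
  (testGraph O F).topologicalClosure

/-- The triples `((f, ∇f), ∇²f)` with `f ∈ H¹₀(O; F) ∩ H²(O; F)`. -/
def H2H10Submodule (O : Set E3) (F : Type*) [NormedAddCommGroup F] [NormedSpace ℝ F] :
    Submodule ℝ ((L2 O F × L2 O (E3 →L[ℝ] F)) × L2 O (E3 →L[ℝ] E3 →L[ℝ] F)) :=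
  (testGraph O F).topologicalClosure.comap (LinearMap.fst ℝ _ _) ⊓
    (weakGraph O (E3 →L[ℝ] F)).comap
      (LinearMap.prodMap (LinearMap.snd ℝ (L2 O F) (L2 O (E3 →L[ℝ] F))) LinearMap.id)

/-- The Banach space `H¹₀(O; ℝ³) ∩ H²(O; ℝ³)` with (a norm equivalent to) the `H²`-norm; an
element is a triple `((f, ∇f), ∇²f)`. -/
abbrev H2H10 (O : Set E3) : Type := H2H10Submodule O E3

theorem isClosed_weakGraph (O : Set E3) (F : Type*) [NormedAddCommGroup F] [NormedSpace ℝ F]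
    [CompleteSpace F] :
    IsClosed (weakGraph O F : Set (L2 O F × L2 O (E3 →L[ℝ] F))) := by
  have hset : (weakGraph O F : Set (L2 O F × L2 O (E3 →L[ℝ] F)))
      = ⋂ (ψ : E3 → ℝ) (_ : IsTestFunction O ψ) (w : E3),
        {q | ∫ x in O, (fderiv ℝ ψ x w) • q.1 x = - ∫ x in O, ψ x • q.2 x w} := by
    ext q
    simp only [mem_iInter]
    rfl
  rw [hset]
  refine isClosed_iInter fun ψ => isClosed_iInter fun hψ => isClosed_iInter fun w => ?_
  have c1 : Continuous fun q : L2 O F × L2 O (E3 →L[ℝ] F) =>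
      ∫ x in O, (fderiv ℝ ψ x w) • q.1 x := by
    have : (fun q : L2 O F × L2 O (E3 →L[ℝ] F) => ∫ x in O, (fderiv ℝ ψ x w) • q.1 x)
        = fun q => (ContinuousLinearMap.lsmul ℝ ℝ).lpPairing (volume.restrict O) 2 2
          (hψ.memLp_fderiv_apply w).toLp q.1 := by
      funext q
      rw [ContinuousLinearMap.lpPairing_eq_integral]
      apply integral_congr_ae
      filter_upwards [(hψ.memLp_fderiv_apply w).coeFn_toLp] with x hx
      rw [hx, ContinuousLinearMap.lsmul_apply]
    rw [this]
    exact (ContinuousLinearMap.continuous _).comp continuous_fst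
  have c2 : Continuous fun q : L2 O F × L2 O (E3 →L[ℝ] F) => ∫ x in O, ψ x • q.2 x w := by
    have : (fun q : L2 O F × L2 O (E3 →L[ℝ] F) => ∫ x in O, ψ x • q.2 x w)
        = fun q => (ContinuousLinearMap.lsmul ℝ ℝ).lpPairing (volume.restrict O) 2 2
          hψ.memLp.toLp ((ContinuousLinearMap.apply ℝ F w).compLpL 2 (volume.restrict O) q.2) := by
      funext q
      rw [ContinuousLinearMap.lpPairing_eq_integral]
      apply integral_congr_ae
      filter_upwards [hψ.memLp.coeFn_toLp,
        (ContinuousLinearMap.apply ℝ F w).coeFn_compLpL q.2] with x hx hy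
      rw [hx, hy, ContinuousLinearMap.lsmul_apply, ContinuousLinearMap.apply_apply]
    rw [this]
    exact (ContinuousLinearMap.continuous _).comp
      ((ContinuousLinearMap.continuous _).comp continuous_snd)
  exact isClosed_eq c1 c2.neg

theorem isClosed_H2H10Submodule (O : Set E3) (F : Type*) [NormedAddCommGroup F]
    [NormedSpace ℝ F] [CompleteSpace F] :
    IsClosed (H2H10Submodule O F :
      Set ((L2 O F × L2 O (E3 →L[ℝ] F)) × L2 O (E3 →L[ℝ] E3 →L[ℝ] F))) := by
  refine IsClosed.inter ?_ ?_
  · exact (testGraph O F).isClosed_topologicalClosure.preimage continuous_fst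
  · exact (isClosed_weakGraph O (E3 →L[ℝ] F)).preimage
      ((continuous_snd.comp continuous_fst).prodMk continuous_snd)

/-- `H¹₀ ∩ H²` is a Banach space, so that Bochner integrals with values in it make sense. -/
instance (O : Set E3) : CompleteSpace (H2H10 O) :=
  (isClosed_H2H10Submodule O E3).completeSpace_coe

end Space

section Operations

variable {O : Set E3}

/-- The velocity field of an element of `H¹₀ ∩ H²`. -/
def vel (a : H2H10 O) : L2 O E3 := a.1.1.1

/-- Its Jacobian. -/
def jac (a : H2H10 O) : L2 O (E3 →L[ℝ] E3) := a.1.1.2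

/-- The inclusion `H¹₀ ∩ H² ⊆ H¹₀`. -/
def toH10 (a : H2H10 O) : H10 O E3 := ⟨a.1.1, a.2.1⟩

/-- `x ↦ g(x) w`: the directional component of an `L²` function with values in linear maps. -/
def applyDir {F : Type*} [NormedAddCommGroup F] [NormedSpace ℝ F] (w : E3)
    (g : L2 O (E3 →L[ℝ] F)) : L2 O F :=
  (ContinuousLinearMap.apply ℝ F w).compLp g

/-- The Laplacian `Δa = ∑ i, ∂ᵢ∂ᵢ a ∈ L²(O; ℝ³)`. -/
def lap (a : H2H10 O) : L2 O E3 :=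
  ∑ i : Fin 3, applyDir (basisVec i) (applyDir (basisVec i) a.1.2)

/-- The divergence `∑ i, ∂ᵢ aᵢ` read off from a Jacobian. -/
def divOf (A : E3 →L[ℝ] E3) : ℝ := ∑ i : Fin 3, A (basisVec i) i

/-- The Frobenius product `A : B` of two Jacobians. -/
def frob (A B : E3 →L[ℝ] E3) : ℝ := ∑ i : Fin 3, inner ℝ (A (basisVec i)) (B (basisVec i))

/-- `∇ · a = 0` in `O`, for a field with Jacobian `J`. -/
def DivFree (J : L2 O (E3 →L[ℝ] E3)) : Prop := ∀ᵐ x ∂(volume.restrict O), divOf (J x) = 0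

/-- The convective term `(a · ∇) b`. -/
def convect (a b : H2H10 O) (x : E3) : E3 := jac b x (vel a x)

/-- The convective term `(u · ∇) u` of the Kelvin–Voigt system. -/
def kvTerm (u : H2H10 O) : E3 → E3 := convect u u

/-- The time derivative `(v · ∇) u + (u · ∇) v` of `(u · ∇) u`, where `v = ∂ₜu`. -/
def kvTermDeriv (u v : H2H10 O) (x : E3) : E3 := convect v u x + convect u v x

/-- The convective term `(U · ∇) u` of the Oseen type system with background velocity `U`. -/
def oseenTerm (U u : H2H10 O) : E3 → E3 := convect U u

/-- The time derivative `(U · ∇) v` of `(U · ∇) u`, where `v = ∂ₜu`. -/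
def oseenTermDeriv (U _u v : H2H10 O) : E3 → E3 := convect U v

/-- The gradient vector field of a scalar function `p ∈ H¹(O)`. -/
def gradVec (p : H1 O ℝ) (x : E3) : E3 := (InnerProductSpace.toDual ℝ E3).symm (p.1.2 x)

/-- The `L²(O; ℝ³)` pairing `∫_O f · g dx`. -/
def pairing (O : Set E3) (f g : E3 → E3) : ℝ := ∫ x in O, inner ℝ (f x) (g x)

/-- The convective contribution `∫_O ((v·∇)φ)·u dx + ∫_O ((u·∇)φ)·v dx` to the equation for `k` in
the Kelvin–Voigt case. -/
def kvKernelTerm (φ u v : H2H10 O) : ℝ :=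
  pairing O (convect v φ) (vel u) + pairing O (convect u φ) (vel v)

/-- The convective contribution `∫_O ((U·∇)φ)·v dx` to the equation for `k` in the Oseen case. -/
def oseenKernelTerm (U φ _u v : H2H10 O) : ℝ := pairing O (convect U φ) (vel v)

/-- `v = (I - μ₁ Δ)⁻¹ f` with homogeneous Dirichlet boundary condition: `v ∈ H¹₀(O; ℝ³)` and
`v - μ₁ Δ v = f` in the weak sense. -/
def IsResolvent (μ₁ : ℝ) (v : H10 O E3) (f : E3 → E3) : Prop :=
  ∀ ψ : E3 → E3, IsTestFunction O ψ →
    pairing O v.1.1 ψ + μ₁ * ∫ x in O, frob (v.1.2 x) (fderiv ℝ ψ x) = pairing O f ψ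

end Operations

section Time

variable {B : Type*} [NormedAddCommGroup B] [NormedSpace ℝ B]

/-- `g` is the weak derivative of `f` on the time interval `(0,T)`. -/
structure HasWeakTimeDeriv (T : ℝ) (f g : ℝ → B) : Prop where
  locallyIntegrable : LocallyIntegrableOn f (Ioo 0 T)
  locallyIntegrable_deriv : LocallyIntegrableOn g (Ioo 0 T)
  integral_eq : ∀ θ : ℝ → ℝ, IsTestFunction (Ioo (0 : ℝ) T) θ →
    ∫ t in Ioo 0 T, deriv θ t • f t = - ∫ t in Ioo 0 T, θ t • g t

/-- `f ∈ L²(0,T; B)`. -/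
def MemL2Time (T : ℝ) (f : ℝ → B) : Prop := MemLp f 2 (volume.restrict (Ioo 0 T))

/-- `f ∈ Hᵐ(0,T; B) = W^{m,2}(0,T; B)`. -/
def MemHTime (T : ℝ) : ℕ → (ℝ → B) → Prop
  | 0, f => MemL2Time T f
  | m + 1, f => MemL2Time T f ∧ ∃ g : ℝ → B, HasWeakTimeDeriv T f g ∧ MemHTime T m g

/-- `f(0) = b` for a class of functions on `(0,T)` having a (necessarily unique) representative
that is continuous on `[0,T]`. -/
def HasInitialValue (T : ℝ) (f : ℝ → B) (b : B) : Prop :=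
  ∃ g : ℝ → B, ContinuousOn g (Icc 0 T) ∧ f =ᵐ[volume.restrict (Ioo 0 T)] g ∧ g 0 = b

end Time

section Systems

variable {O : Set E3}

/-- The memory term `∫₀ᵗ k(t-s) Δa(s) ds ∈ L²(O; ℝ³)`. -/
def memory (k : ℝ → ℝ) (a : ℝ → H2H10 O) (t : ℝ) : L2 O E3 :=
  ∫ s in (0 : ℝ)..t, k (t - s) • lap (a s)

/-- `u(t) = u₀ + ∫₀ᵗ v(s) ds`. -/
def primitive (u₀ : H2H10 O) (v : ℝ → H2H10 O) (t : ℝ) : H2H10 O :=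
  u₀ + ∫ s in (0 : ℝ)..t, v s

/-- The initial condition `p(·,0) = p₀` for the pressure. As pressures are determined up to
functions of time only, it is imposed on the gradient, in the sense of distributions on `O`. -/
def HasInitialPressure (T : ℝ) (p : ℝ → H1 O ℝ) (p₀ : H1 O ℝ) : Prop :=
  ∀ ψ : E3 → E3, IsTestFunction O ψ →
    HasInitialValue T (fun t => pairing O (gradVec (p t)) ψ) (pairing O (gradVec p₀) ψ)

/-- `(u, k)`, with pressure `p ∈ L²(0,T; H¹(O))`, solves the inverse problem on `(0,T)` with the
convective term `N u`: `N = kvTerm` for the Kelvin–Voigt and `N = oseenTerm U` for the Oseen type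
system. The no-slip condition `u = 0` on `∂O` is contained in `u(t) ∈ H¹₀(O; ℝ³)`. -/
structure SolvesInverse (N : H2H10 O → E3 → E3) (T μ₀ μ₁ : ℝ) (u₀ φ : H2H10 O) (r : ℝ → ℝ)
    (u : ℝ → H2H10 O) (k : ℝ → ℝ) (p : ℝ → H1 O ℝ) : Prop where
  pressure_mem : MemL2Time T p
  momentum : ∃ v : ℝ → H2H10 O, HasWeakTimeDeriv T u v ∧
    ∀ᵐ t ∂(volume.restrict (Ioo 0 T)), ∀ᵐ x ∂(volume.restrict O),
      vel (v t) x - μ₁ • lap (v t) x - μ₀ • lap (u t) x + N (u t) x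
        - memory k u t x + gradVec (p t) x = 0
  incompressible : ∀ᵐ t ∂(volume.restrict (Ioo 0 T)), DivFree (jac (u t))
  initial : HasInitialValue T u u₀
  overdetermination : ∀ᵐ t ∂(volume.restrict (Ioo 0 T)),
    pairing O (fun x => vel φ x - μ₁ • lap φ x) (vel (u t)) = r t

/-- `(v, k)`, with pressure `p ∈ L²(0,T; H¹(O))`, solves the differentiated system on `(0,T)`,
with `(N', K) = (kvTermDeriv, kvKernelTerm φ)` in the Kelvin–Voigt case and
`(N', K) = (oseenTermDeriv U, oseenKernelTerm U φ)` in the Oseen case.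

The momentum equation reads `F + ∇ ∂ₜp = 0`, where
`F = ∂ₜv - μ₁ ∂ₜΔv - μ₀ Δv - k Δu₀ - ∫₀ᵗ k(t-s) Δv(s) ds + N' u v` and `u = u₀ + ∫₀ᵗ v`.
As `p` is not assumed to be differentiable in time, `∇ ∂ₜp` is the distributional derivative: the
equation is understood in the sense of distributions on `O × (0,T)`, that is, `∂ₜ ⟨∇p, ψ⟩ = - ⟨F, ψ⟩` weakly on `(0,T)` for all test fields `ψ` on `O`.

The last field is the Volterra equation for `k`; the factor in front of its right-hand side is
`α = (∫_O φ · Δu₀ dx)⁻¹`. -/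
structure SolvesDifferentiated (N' : H2H10 O → H2H10 O → E3 → E3)
    (K : H2H10 O → H2H10 O → ℝ) (T μ₀ μ₁ : ℝ) (u₀ φ : H2H10 O) (v₀ : H10 O E3) (r'' : ℝ → ℝ)
    (v : ℝ → H2H10 O) (k : ℝ → ℝ) (p : ℝ → H1 O ℝ) : Prop where
  pressure_mem : MemL2Time T p
  momentum : ∃ w : ℝ → H2H10 O, HasWeakTimeDeriv T v w ∧
    ∀ ψ : E3 → E3, IsTestFunction O ψ →
      HasWeakTimeDeriv T (fun t => pairing O (gradVec (p t)) ψ)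
        (fun t => - pairing O (fun x =>
          vel (w t) x - μ₁ • lap (w t) x - μ₀ • lap (v t) x - k t • lap u₀ x
            - memory k v t x + N' (primitive u₀ v t) (v t) x) ψ)
  incompressible : ∀ᵐ t ∂(volume.restrict (Ioo 0 T)), DivFree (jac (v t))
  initial : HasInitialValue T (fun t => toH10 (v t)) v₀
  kernel : ∀ᵐ t ∂(volume.restrict (Ioo 0 T)),
    k t = (pairing O (vel φ) (lap u₀))⁻¹ *
      (r'' t - μ₀ * pairing O (vel (v t)) (lap φ)
        - (∫ s in (0 : ℝ)..t, k (t - s) * pairing O (vel (v s)) (lap φ))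
        - K (primitive u₀ v t) (v t))

end Systems

end KelvinVoigt

end

open KelvinVoigt

/-! The momentum equation is read in `L43 O`, that is `L^{4/3}(O; ℝ³)`: `H¹₀ ⊆ L⁴` on bounded sets
puts `(a·∇)b` there, and elements of `H¹₀` can be used as test functions. Let `S(t)` be the left
side of (I) without the pressure, evaluated along `u = u₀ + ∫v` with the continuous representative
`V` of `v`. Then `S` is absolutely continuous with values in `L^{4/3}` and its derivative `F` is the
left side of (D) without the pressure (`isPrim_residual`). The memory term can be differentiated
with `k` merely integrable, because the derivative falls on `Δu` and leaves `k Δu₀ + k * Δv`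
(`IsPrim.volterra`). So (I) says `S + ∇p = 0`, while (D) says `∂ₜ⟨∇p, ψ⟩ = -⟨F, ψ⟩`: each follows
from the other by differentiating or integrating, up to the value at `t = 0`.

Initial value. By the equation for `v₀`, `S(0) + ∇p₀` is weakly `(I - μ₁Δ)(V(0) - v₀)`. From (I),
`S(0)` annihilates divergence free fields in `H¹₀`; testing with `V(0) - v₀` makes its energy
vanish, so `V(0) = v₀` and `p(0) = p₀` (`toH10_eq_of_residual_initial`). From (D), `V(0) = v₀` and
`p(0) = p₀` are given and fix the constant of integration.

Kernel. Tested with the divergence free `φ`, the pressure drops out. The Laplacian is symmetric and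
convection is skew (`dualL_lap_comm`, `dualL_convectL_skew`), so `⟨F, φ⟩ = 0` is the equation for
`k` with `ℓ(∂ₜv)` in place of `r''`, where `ℓ(a) = ∫ (I - μ₁Δ)φ · a` (`weight_balance`). Hence that
equation is equivalent to `r'' = ℓ(∂ₜv)`, and, given `r(0)` and `r'(0)`, to `r = ℓ(u)`.

All integrations by parts in space are proved for test functions and extended to `H¹₀` by density,
so no regularity of `∂O` enters. The structure `ConvectiveTerm` collects what is needed of the
nonlinearity, so one argument serves both systems. -/

noncomputable section

namespace KelvinVoigt

/-! ### Absolutely continuous paths and weak time derivatives. -/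

section TimeCalculus

variable {B C D : Type*} [NormedAddCommGroup B] [NormedSpace ℝ B]
  [NormedAddCommGroup C] [NormedSpace ℝ C] [NormedAddCommGroup D] [NormedSpace ℝ D]
  {T : ℝ}

/-- Integration by parts for Banach space valued primitives. -/
theorem integral_bilin_primitive [CompleteSpace B] [CompleteSpace C] [CompleteSpace D]
    (L : B →L[ℝ] C →L[ℝ] D) {f : ℝ → B} {g : ℝ → C} {t : ℝ}
    (hf : IntegrableOn f (Ioc 0 t)) (hg : IntegrableOn g (Ioc 0 t)) :
    IntegrableOn (fun r => L (∫ s in Ioc 0 r, f s) (g r)) (Ioc 0 t) ∧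
    IntegrableOn (fun s => L (f s) (∫ r in Ioc 0 s, g r)) (Ioc 0 t) ∧
    (∫ r in Ioc 0 t, L (∫ s in Ioc 0 r, f s) (g r)) +
      (∫ s in Ioc 0 t, L (f s) (∫ r in Ioc 0 s, g r)) =
      L (∫ s in Ioc 0 t, f s) (∫ r in Ioc 0 t, g r) := by
  set μ : Measure ℝ := volume.restrict (Ioc 0 t) with hμ
  have hH : Integrable (fun z : ℝ × ℝ => L (f z.1) (g z.2)) (μ.prod μ) :=
    hf.op_fst_snd (by fun_prop) ⟨‖L‖, L.le_opNorm₂⟩ hg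
  -- Fubini on the square `(0,t]²`, cut along the diagonal: the part `s ≤ r` gives the first
  -- integral, its complement the second, and together they give the product.
  have hS : MeasurableSet {z : ℝ × ℝ | z.1 ≤ z.2} :=
    measurableSet_le measurable_fst measurable_snd
  have i1 := hH.indicator hS
  have i2 := hH.indicator hS.compl
  have e1 : ∀ r ∈ Ioc 0 t, ∫ s, {z : ℝ × ℝ | z.1 ≤ z.2}.indicator
      (fun z : ℝ × ℝ => L (f z.1) (g z.2)) (s, r) ∂μ = L (∫ s in Ioc 0 r, f s) (g r) := by
    intro r hr
    have : (fun s => {z : ℝ × ℝ | z.1 ≤ z.2}.indicator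
        (fun z : ℝ × ℝ => L (f z.1) (g z.2)) (s, r)) =
        (Iic r).indicator (fun s => L.flip (g r) (f s)) := by
      funext s
      simp [indicator]
    rw [this, integral_indicator measurableSet_Iic, hμ, Measure.restrict_restrict measurableSet_Iic,
      inter_comm, Ioc_inter_Iic, min_eq_right hr.2,
      ContinuousLinearMap.integral_comp_comm _ (hf.mono_set (Ioc_subset_Ioc_right hr.2))]
    rfl
  have e2 : ∀ s ∈ Ioc 0 t, ∫ r, {z : ℝ × ℝ | z.1 ≤ z.2}ᶜ.indicator
      (fun z : ℝ × ℝ => L (f z.1) (g z.2)) (s, r) ∂μ = L (f s) (∫ r in Ioc 0 s, g r) := by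
    intro s hs
    have : (fun r => {z : ℝ × ℝ | z.1 ≤ z.2}ᶜ.indicator
        (fun z : ℝ × ℝ => L (f z.1) (g z.2)) (s, r)) =
        (Iio s).indicator (fun r => L (f s) (g r)) := by
      funext r
      simp [indicator]
    have h3 : Iio s ∩ Ioc 0 t = Ioo 0 s := by
      ext x
      simp only [mem_inter_iff, mem_Iio, mem_Ioc, mem_Ioo]
      constructor
      · rintro ⟨h1, h2, -⟩; exact ⟨h2, h1⟩
      · rintro ⟨h1, h2⟩; exact ⟨h2, h1, h2.le.trans hs.2⟩
    rw [this, integral_indicator measurableSet_Iio, hμ, Measure.restrict_restrict measurableSet_Iio,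
      h3, ← integral_Ioc_eq_integral_Ioo,
      ContinuousLinearMap.integral_comp_comm _ (hg.mono_set (Ioc_subset_Ioc_right hs.2))]
  refine ⟨?_, ?_, ?_⟩
  · refine (i1.integral_prod_right).congr ?_
    exact (ae_restrict_iff' measurableSet_Ioc).2 (Filter.Eventually.of_forall e1)
  · refine (i2.integral_prod_left).congr ?_
    exact (ae_restrict_iff' measurableSet_Ioc).2 (Filter.Eventually.of_forall e2)
  · rw [← integral_prod_bilin L hf hg, ← integral_add_compl hS hH, ← integral_indicator hS,
      ← integral_indicator hS.compl, integral_prod_symm _ i1, integral_prod _ i2]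
    congr 1
    · exact (setIntegral_congr_fun measurableSet_Ioc e1).symm
    · exact (setIntegral_congr_fun measurableSet_Ioc e2).symm

/-- `f` is absolutely continuous on `[0,T]` with integrable derivative `g`. -/
structure IsPrim (T : ℝ) (f g : ℝ → B) : Prop where
  integrableOn : IntegrableOn g (Ioo 0 T)
  eq_add : ∀ t ∈ Icc 0 T, f t = f 0 + ∫ s in (0 : ℝ)..t, g s

theorem integrableOn_Ioc_of_Ioo {E : Type*} [NormedAddCommGroup E] {g : ℝ → E} (h : IntegrableOn g (Ioo 0 T)) {t : ℝ}
    (ht : t ≤ T) : IntegrableOn g (Ioc 0 t) :=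
  ((integrableOn_Ioc_iff_integrableOn_Ioo).2 h).mono_set (Ioc_subset_Ioc_right ht)

namespace IsPrim

variable {f f' g g' : ℝ → B}

theorem of_integrableOn (hg : IntegrableOn g (Ioo 0 T)) (c : B) :
    IsPrim T (fun t => c + ∫ s in (0 : ℝ)..t, g s) g :=
  ⟨hg, fun t _ => by simp⟩

theorem continuousOn (h : IsPrim T f g) : ContinuousOn f (Icc 0 T) := by
  rcases lt_or_ge T 0 with hT | hT
  · simp [Icc_eq_empty_of_lt hT]
  refine ContinuousOn.congr ?_ h.eq_add
  refine continuousOn_const.add ?_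
  have := intervalIntegral.continuousOn_primitive_interval (a := 0) (b := T) (f := g)
    (μ := volume) (by
      rw [uIcc_of_le hT]
      exact (integrableOn_Icc_iff_integrableOn_Ioo).2 h.integrableOn)
  rwa [uIcc_of_le hT] at this

theorem congr (h : IsPrim T f g) (hf : ∀ t ∈ Icc 0 T, f' t = f t)
    (hg : g' =ᵐ[volume.restrict (Ioo 0 T)] g) : IsPrim T f' g' := by
  refine ⟨h.integrableOn.congr hg.symm, fun t ht => ?_⟩
  have h0 : (0 : ℝ) ∈ Icc 0 T := ⟨le_rfl, ht.1.trans ht.2⟩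
  rw [hf t ht, hf 0 h0, h.eq_add t ht]
  congr 1
  rw [intervalIntegral.integral_of_le ht.1, intervalIntegral.integral_of_le ht.1,
    integral_Ioc_eq_integral_Ioo, integral_Ioc_eq_integral_Ioo]
  exact integral_congr_ae (ae_restrict_of_ae_restrict_of_subset (Ioo_subset_Ioo_right ht.2) hg.symm)

theorem add (h : IsPrim T f g) (h' : IsPrim T f' g') :
    IsPrim T (fun t => f t + f' t) (fun t => g t + g' t) := by
  refine ⟨h.integrableOn.add h'.integrableOn, fun t ht => ?_⟩
  rw [h.eq_add t ht, h'.eq_add t ht, intervalIntegral.integral_of_le ht.1,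
    intervalIntegral.integral_of_le ht.1, intervalIntegral.integral_of_le ht.1,
    integral_add (integrableOn_Ioc_of_Ioo h.integrableOn ht.2)
      (integrableOn_Ioc_of_Ioo h'.integrableOn ht.2)]
  abel

theorem clm [CompleteSpace B] [CompleteSpace C] (h : IsPrim T f g) (L : B →L[ℝ] C) :
    IsPrim T (fun t => L (f t)) (fun t => L (g t)) := by
  refine ⟨L.integrable_comp h.integrableOn, fun t ht => ?_⟩
  rw [h.eq_add t ht, map_add, intervalIntegral.integral_of_le ht.1,
    intervalIntegral.integral_of_le ht.1,
    L.integral_comp_comm (integrableOn_Ioc_of_Ioo h.integrableOn ht.2)]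

theorem sub [CompleteSpace B] (h : IsPrim T f g) (h' : IsPrim T f' g') :
    IsPrim T (fun t => f t - f' t) (fun t => g t - g' t) := by
  simpa [sub_eq_add_neg] using h.add (h'.clm (-ContinuousLinearMap.id ℝ B))

theorem const_smul [CompleteSpace B] (h : IsPrim T f g) (c : ℝ) :
    IsPrim T (fun t => c • f t) (fun t => c • g t) := by
  simpa using h.clm (c • ContinuousLinearMap.id ℝ B)

theorem const (c : B) : IsPrim T (fun _ => c) (fun _ => 0) := ⟨integrableOn_zero, by simp⟩

/-- Leibniz rule. Writing both factors as initial value plus primitive, only the product of the two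
primitives is not linear in a single path, and `integral_bilin_primitive` handles it. -/
theorem bilin [CompleteSpace B] [CompleteSpace C] [CompleteSpace D]
    (L : B →L[ℝ] C →L[ℝ] D) {φ γ : ℝ → C} (h : IsPrim T f g) (h' : IsPrim T φ γ) :
    IsPrim T (fun t => L (f t) (φ t)) (fun t => L (g t) (φ t) + L (f t) (γ t)) := by
  rcases lt_or_ge T 0 with hT | hT
  · exact ⟨by simp [Ioo_eq_empty_of_le hT.le], by simp [Icc_eq_empty_of_lt hT]⟩
  have key := fun t (ht : t ∈ Icc 0 T) => integral_bilin_primitive L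
    (integrableOn_Ioc_of_Ioo h.integrableOn ht.2) (integrableOn_Ioc_of_Ioo h'.integrableOn ht.2)
  have ef : ∀ t ∈ Icc 0 T, f t = f 0 + ∫ s in Ioc 0 t, g s := fun t ht => by
    rw [h.eq_add t ht, intervalIntegral.integral_of_le ht.1]
  have eφ : ∀ t ∈ Icc 0 T, φ t = φ 0 + ∫ s in Ioc 0 t, γ s := fun t ht => by
    rw [h'.eq_add t ht, intervalIntegral.integral_of_le ht.1]
  have main : ∀ t ∈ Icc 0 T,
      IntegrableOn (fun t => L (g t) (φ t) + L (f t) (γ t)) (Ioc 0 t) ∧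
      L (f t) (φ t) = L (f 0) (φ 0) + ∫ s in Ioc 0 t, (L (g s) (φ s) + L (f s) (γ s)) := by
    intro t ht
    obtain ⟨k1, k2, k3⟩ := key t ht
    have i1 := integrableOn_Ioc_of_Ioo h.integrableOn ht.2
    have i2 := integrableOn_Ioc_of_Ioo h'.integrableOn ht.2
    have j1 : IntegrableOn (fun s => L (g s) (φ 0)) (Ioc 0 t) := (L.flip (φ 0)).integrable_comp i1
    have j2 : IntegrableOn (fun s => L (f 0) (γ s)) (Ioc 0 t) := (L (f 0)).integrable_comp i2
    have a1 : IntegrableOn (fun s => L (g s) (φ 0) + L (g s) (∫ r in Ioc 0 s, γ r)) (Ioc 0 t) :=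
      j1.add k2
    have a2 : IntegrableOn (fun s => L (f 0) (γ s) + L (∫ r in Ioc 0 s, g r) (γ s)) (Ioc 0 t) :=
      j2.add k1
    have e : ∀ s ∈ Ioc 0 t, (L (g s) (φ 0) + L (g s) (∫ r in Ioc 0 s, γ r)) +
        (L (f 0) (γ s) + L (∫ r in Ioc 0 s, g r) (γ s)) = L (g s) (φ s) + L (f s) (γ s) := by
      intro s hs
      have hs' : s ∈ Icc 0 T := ⟨hs.1.le, hs.2.trans ht.2⟩
      rw [ef s hs', eφ s hs']
      simp
    refine ⟨(a1.add a2).congr_fun e measurableSet_Ioc, ?_⟩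
    rw [← setIntegral_congr_fun measurableSet_Ioc e, integral_add a1 a2,
      integral_add j1 k2, integral_add j2 k1, (L (f 0)).integral_comp_comm i2]
    have : ∫ s in Ioc 0 t, L (g s) (φ 0) = L (∫ s in Ioc 0 t, g s) (φ 0) :=
      (L.flip (φ 0)).integral_comp_comm i1
    rw [this, ef t ht, eφ t ht]
    simp only [map_add, _root_.add_apply]
    rw [← k3]
    abel
  refine ⟨((main T ⟨hT, le_rfl⟩).1).mono_set Ioo_subset_Ioc_self, fun t ht => ?_⟩
  rw [intervalIntegral.integral_of_le ht.1]
  exact (main t ht).2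

/-- A test function is the primitive of its own derivative, so the Leibniz rule applies to `θ • f`,
whose values at both endpoints are zero. -/
theorem hasWeakTimeDeriv [CompleteSpace B] (hT : 0 < T) (h : IsPrim T f g) :
    HasWeakTimeDeriv T f g := by
  refine ⟨(h.continuousOn.mono Ioo_subset_Icc_self).locallyIntegrableOn measurableSet_Ioo,
    h.integrableOn.locallyIntegrableOn, fun θ hθ => ?_⟩
  have hd : Continuous (deriv θ) := hθ.smooth.continuous_deriv (by simp)
  have h0 : θ 0 = 0 := image_eq_zero_of_notMem_tsupport fun h => by
    simpa using (hθ.support_subset h).1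
  have hTT : θ T = 0 := image_eq_zero_of_notMem_tsupport fun h => by
    simpa using (hθ.support_subset h).2
  have hp : IsPrim T θ (deriv θ) := by
    refine ⟨hd.integrableOn_Icc.mono_set Ioo_subset_Icc_self, fun t _ => ?_⟩
    rw [intervalIntegral.integral_deriv_eq_sub
      (fun x _ => hθ.smooth.differentiable (by simp) x) (hd.intervalIntegrable _ _)]
    ring
  have := (hp.bilin (ContinuousLinearMap.lsmul ℝ ℝ) h)
  have e := this.eq_add T ⟨hT.le, le_rfl⟩
  simp only [ContinuousLinearMap.lsmul_apply, h0, hTT, zero_smul, zero_add] at e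
  rw [intervalIntegral.integral_of_le hT.le, integral_Ioc_eq_integral_Ioo] at e
  have c1 : IntegrableOn (fun t => deriv θ t • f t) (Ioo 0 T) :=
    ((hd.continuousOn.smul h.continuousOn).integrableOn_Icc).mono_set Ioo_subset_Icc_self
  have c2 : IntegrableOn (fun t => θ t • g t) (Ioo 0 T) := by
    have := this.integrableOn.sub c1
    refine this.congr (Filter.Eventually.of_forall fun t => ?_)
    simp
  rw [integral_add c1 c2] at e
  exact eq_neg_of_add_eq_zero_left e.symm

end IsPrim

namespace HasWeakTimeDeriv

variable {f f' g g' : ℝ → B}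

theorem congr (h : HasWeakTimeDeriv T f g) (hf : f' =ᵐ[volume.restrict (Ioo 0 T)] f)
    (hg : g' =ᵐ[volume.restrict (Ioo 0 T)] g) : HasWeakTimeDeriv T f' g' := by
  refine ⟨?_, ?_, fun θ hθ => ?_⟩
  · exact h.locallyIntegrable.congr hf.symm
  · exact h.locallyIntegrable_deriv.congr hg.symm
  · have e1 : ∫ t in Ioo 0 T, deriv θ t • f' t = ∫ t in Ioo 0 T, deriv θ t • f t :=
      integral_congr_ae (by filter_upwards [hf] with t ht; rw [ht])
    have e2 : ∫ t in Ioo 0 T, θ t • g' t = ∫ t in Ioo 0 T, θ t • g t :=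
      integral_congr_ae (by filter_upwards [hg] with t ht; rw [ht])
    rw [e1, e2, h.integral_eq θ hθ]

end HasWeakTimeDeriv

theorem IsTestFunction.integrableOn_smul {θ : ℝ → ℝ} (hθ : IsTestFunction (Ioo 0 T) θ)
    {f : ℝ → B} (hf : LocallyIntegrableOn f (Ioo 0 T)) :
    IntegrableOn (fun t => θ t • f t) (Ioo 0 T) := by
  have h1 : IntegrableOn f (tsupport θ) :=
    hf.integrableOn_compact_subset hθ.support_subset hθ.compact_support
  have h2 : IntegrableOn (fun t => θ t • f t) (tsupport θ) :=
    h1.continuousOn_smul hθ.smooth.continuous.continuousOn hθ.compact_support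
  have h3 : Integrable (fun t => θ t • f t) := by
    refine (integrableOn_iff_integrable_of_support_subset ?_).1 h2
    exact (Function.support_smul_subset_left θ f).trans (subset_tsupport θ)
  exact h3.integrableOn

theorem IsTestFunction.deriv {θ : ℝ → ℝ} (hθ : IsTestFunction (Ioo 0 T) θ) :
    IsTestFunction (Ioo 0 T) (deriv θ) :=
  ⟨hθ.smooth.deriv' , hθ.compact_support.deriv,
    (closure_minimal (support_deriv_subset) (isClosed_tsupport _)).trans hθ.support_subset⟩

theorem ae_eq_zero_of_forall_test [CompleteSpace B] {f : ℝ → B}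
    (hf : LocallyIntegrableOn f (Ioo 0 T))
    (h : ∀ θ : ℝ → ℝ, IsTestFunction (Ioo 0 T) θ → ∫ t in Ioo 0 T, θ t • f t = 0) :
    f =ᵐ[volume.restrict (Ioo 0 T)] 0 := by
  refine (ae_restrict_iff' measurableSet_Ioo).2 ?_
  refine isOpen_Ioo.ae_eq_zero_of_integral_contDiff_smul_eq_zero hf fun θ h1 h2 h3 => ?_
  rw [← h θ ⟨h1, h2, h3⟩, setIntegral_eq_integral_of_forall_compl_eq_zero]
  intro t ht
  rw [image_eq_zero_of_notMem_tsupport fun h => ht (h3 h), zero_smul]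

theorem exists_test_integral_eq_one (hT : 0 < T) :
    ∃ η : ℝ → ℝ, IsTestFunction (Ioo 0 T) η ∧ ∫ t, η t = 1 := by
  let b : ContDiffBump (T / 2) := ⟨T / 8, T / 4, by linarith, by linarith⟩
  refine ⟨b.normed volume, ⟨b.contDiff_normed, b.hasCompactSupport_normed, ?_⟩,
    b.integral_normed⟩
  rw [b.tsupport_normed_eq, Real.closedBall_eq_Icc]
  exact fun x hx => ⟨by have := hx.1; simp only [b] at this; linarith,
    by have := hx.2; simp only [b] at this; linarith⟩

/-- The primitive starting at `0` vanishes to the left of the support because nothing has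
accumulated, and to the right because the total integral is zero. -/
theorem IsTestFunction.exists_primitive {θ : ℝ → ℝ} (hθ : IsTestFunction (Ioo 0 T) θ)
    (h0 : ∫ t, θ t = 0) : ∃ ζ : ℝ → ℝ, IsTestFunction (Ioo 0 T) ζ ∧ _root_.deriv ζ = θ := by
  have hc := hθ.smooth.continuous
  have hd : ∀ x, HasDerivAt (fun t => ∫ s in (0 : ℝ)..t, θ s) (θ x) x := fun x =>
    intervalIntegral.integral_hasDerivAt_right (hc.intervalIntegrable _ _)
      (hc.stronglyMeasurableAtFilter _ _) hc.continuousAt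
  have hde : _root_.deriv (fun t => ∫ s in (0 : ℝ)..t, θ s) = θ := funext fun x => (hd x).deriv
  obtain ⟨a, b, ha, hb, hab⟩ : ∃ a b, 0 < a ∧ b < T ∧ tsupport θ ⊆ Icc a b := by
    rcases (tsupport θ).eq_empty_or_nonempty with he | hne
    -- With empty support `a ≤ b` is not needed; any `a > 0` and `b < T` will do.
    · exact ⟨1, T - 1, one_pos, by linarith, by simp [he]⟩
    · have hcs : IsCompact (tsupport θ) := hθ.compact_support
      exact ⟨sInf (tsupport θ), sSup (tsupport θ), (hθ.support_subset (hcs.sInf_mem hne)).1,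
        (hθ.support_subset (hcs.sSup_mem hne)).2,
        fun x hx => ⟨csInf_le hcs.bddBelow hx, le_csSup hcs.bddAbove hx⟩⟩
  have hz : ∀ x, x ∉ Icc a b → θ x = 0 := fun x hx =>
    image_eq_zero_of_notMem_tsupport fun h => hx (hab h)
  have hsupp : Function.support (fun t => ∫ s in (0 : ℝ)..t, θ s) ⊆ Icc a b := by
    intro t ht
    by_contra hn
    apply ht
    simp only
    by_cases hta : t < a
    · apply intervalIntegral.integral_zero_ae
      refine Filter.Eventually.of_forall fun s hs => hz s fun h => ?_
      rcases le_total 0 t with h' | h'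
      · rw [uIoc_of_le h'] at hs
        linarith [h.1, hs.2]
      · rw [uIoc_of_ge h'] at hs
        linarith [h.1, hs.2]
    · have htb : b < t := by
        by_contra h
        exact hn ⟨not_lt.1 hta, not_lt.1 h⟩
      rw [intervalIntegral.integral_of_le (by linarith), ← h0,
        setIntegral_eq_integral_of_forall_compl_eq_zero]
      intro s hs
      refine hz s fun h => hs ⟨by linarith [h.1], by linarith [h.2]⟩
  have hts := closure_minimal hsupp isClosed_Icc
  refine ⟨_, ⟨?_, ?_, hts.trans (Icc_subset_Ioo ha hb)⟩, hde⟩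
  · rw [contDiff_infty_iff_deriv, hde]
    exact ⟨fun x => (hd x).differentiableAt, hθ.smooth⟩
  · exact HasCompactSupport.of_support_subset_isCompact isCompact_Icc hsupp

/-- A function on an interval whose weak derivative vanishes is constant. -/
theorem exists_ae_eq_const [CompleteSpace B] (hT : 0 < T) {f : ℝ → B}
    (hf : LocallyIntegrableOn f (Ioo 0 T))
    (h : ∀ θ : ℝ → ℝ, IsTestFunction (Ioo 0 T) θ → ∫ t in Ioo 0 T, deriv θ t • f t = 0) :
    ∃ c : B, f =ᵐ[volume.restrict (Ioo 0 T)] fun _ => c := by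
  obtain ⟨η, hη, hη1⟩ := exists_test_integral_eq_one hT
  -- Since `∫ η = 1`, a constant equals its own `η`-average, which dictates the witness.
  refine ⟨∫ t in Ioo 0 T, η t • f t, ?_⟩
  set c := ∫ t in Ioo 0 T, η t • f t
  have hlc : LocallyIntegrableOn (fun t => f t - c) (Ioo 0 T) :=
    hf.sub ((locallyIntegrable_const c).locallyIntegrableOn _)
  have hint : ∀ θ : ℝ → ℝ, IsTestFunction (Ioo 0 T) θ → ∫ t in Ioo 0 T, θ t = ∫ t, θ t :=
    fun θ hθ => setIntegral_eq_integral_of_forall_compl_eq_zero fun t ht =>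
      image_eq_zero_of_notMem_tsupport fun h => ht (hθ.support_subset h)
  have hi : ∀ θ : ℝ → ℝ, IsTestFunction (Ioo 0 T) θ → Integrable θ := fun θ hθ =>
    hθ.smooth.continuous.integrable_of_hasCompactSupport hθ.compact_support
  have := ae_eq_zero_of_forall_test hlc fun θ hθ => ?_
  · filter_upwards [this] with t ht
    exact sub_eq_zero.1 ht
  set I := ∫ t, θ t
  -- Du Bois-Reymond: subtracting `I * η` makes the integral zero, so the difference is the
  -- derivative of a test function and the hypothesis applies.
  have hθη : IsTestFunction (Ioo 0 T) (fun t => θ t - I * η t) := by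
    refine ⟨hθ.smooth.sub (contDiff_const.mul hη.smooth), ?_, ?_⟩
    · exact hθ.compact_support.sub hη.compact_support.mul_left
    · refine (tsupport_sub _ _).trans (union_subset hθ.support_subset ?_)
      exact (tsupport_mul_subset_right).trans hη.support_subset
  obtain ⟨ζ, hζ, hζd⟩ := hθη.exists_primitive (by
    rw [integral_sub (hi θ hθ) ((hi η hη).const_mul I), integral_const_mul, hη1]
    simp [I])
  have e := h ζ hζ
  rw [hζd] at e
  simp only [sub_smul, mul_smul] at e
  have hIη : IntegrableOn (fun t => I • η t • f t) (Ioo 0 T) := (hη.integrableOn_smul hf).smul I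
  rw [integral_sub (hθ.integrableOn_smul hf) hIη,
    integral_smul, sub_eq_zero] at e
  simp only [smul_sub]
  rw [integral_sub (hθ.integrableOn_smul hf) ((hi θ hθ).integrableOn.smul_const c),
    e, integral_smul_const, hint θ hθ, sub_self]

namespace HasWeakTimeDeriv

variable {f f' g g' : ℝ → B}

theorem unique [CompleteSpace B] (h : HasWeakTimeDeriv T f g) (h' : HasWeakTimeDeriv T f g') :
    g =ᵐ[volume.restrict (Ioo 0 T)] g' := by
  have := ae_eq_zero_of_forall_test (h.locallyIntegrable_deriv.sub h'.locallyIntegrable_deriv)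
    fun θ hθ => by
      simp only [Pi.sub_apply, smul_sub]
      rw [integral_sub (hθ.integrableOn_smul h.locallyIntegrable_deriv)
        (hθ.integrableOn_smul h'.locallyIntegrable_deriv), sub_eq_zero]
      exact neg_injective ((h.integral_eq θ hθ).symm.trans (h'.integral_eq θ hθ))
  filter_upwards [this] with t ht
  exact sub_eq_zero.1 ht

/-- Two functions with the same weak derivative differ by a constant. -/
theorem exists_ae_eq_add_const [CompleteSpace B] (hT : 0 < T) (h : HasWeakTimeDeriv T f g)
    (h' : HasWeakTimeDeriv T f' g) :
    ∃ c : B, f =ᵐ[volume.restrict (Ioo 0 T)] fun t => c + f' t := by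
  obtain ⟨c, hc⟩ := exists_ae_eq_const hT (h.locallyIntegrable.sub h'.locallyIntegrable)
    fun θ hθ => by
      simp only [Pi.sub_apply, smul_sub]
      rw [integral_sub (hθ.deriv.integrableOn_smul h.locallyIntegrable)
        (hθ.deriv.integrableOn_smul h'.locallyIntegrable), h.integral_eq θ hθ,
        h'.integral_eq θ hθ, sub_self]
  refine ⟨c, ?_⟩
  filter_upwards [hc] with t ht
  rw [← ht, Pi.sub_apply, sub_add_cancel]

end HasWeakTimeDeriv

theorem eqOn_Icc_of_ae_eq {E : Type*} [NormedAddCommGroup E] (hT : 0 < T) {f g : ℝ → E} (hf : ContinuousOn f (Icc 0 T))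
    (hg : ContinuousOn g (Icc 0 T)) (h : f =ᵐ[volume.restrict (Ioo 0 T)] g) :
    EqOn f g (Icc 0 T) := by
  have h' : f =ᵐ[volume.restrict (Icc 0 T)] g := by
    rwa [Measure.restrict_congr_set Ioo_ae_eq_Icc] at h
  exact Measure.eqOn_Icc_of_ae_eq volume hT.ne h' hf hg

/-- A function with an integrable weak derivative and an initial value is a primitive. -/
theorem HasWeakTimeDeriv.ae_eq_primitive [CompleteSpace B] (hT : 0 < T) {f g : ℝ → B} {b : B}
    (h : HasWeakTimeDeriv T f g) (hg : IntegrableOn g (Ioo 0 T)) (hb : HasInitialValue T f b) :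
    f =ᵐ[volume.restrict (Ioo 0 T)] fun t => b + ∫ s in (0 : ℝ)..t, g s := by
  have hp := IsPrim.of_integrableOn hg 0
  obtain ⟨c, hc⟩ := h.exists_ae_eq_add_const hT (hp.hasWeakTimeDeriv hT)
  obtain ⟨f₁, hf₁, hff₁, h0⟩ := hb
  have := eqOn_Icc_of_ae_eq hT hf₁ (continuousOn_const.add hp.continuousOn) (hff₁.symm.trans hc)
    ⟨le_rfl, hT.le⟩
  simp only [Pi.add_apply, h0] at this
  simp only [intervalIntegral.integral_same, add_zero] at this
  rw [this]
  simpa using hc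

/-- Supplies the continuous representative, whose value at `0` has a meaning although `f` is only
given almost everywhere. -/
theorem HasWeakTimeDeriv.exists_isPrim [CompleteSpace B] (hT : 0 < T) {f g : ℝ → B}
    (h : HasWeakTimeDeriv T f g) (hg : IntegrableOn g (Ioo 0 T)) :
    ∃ F, IsPrim T F g ∧ f =ᵐ[volume.restrict (Ioo 0 T)] F := by
  have hp := IsPrim.of_integrableOn hg 0
  obtain ⟨c, hc⟩ := h.exists_ae_eq_add_const hT (hp.hasWeakTimeDeriv hT)
  exact ⟨_, IsPrim.of_integrableOn hg c, by simpa using hc⟩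

/-- Used to differentiate linear constraints in time, such as vanishing divergence or orthogonality
of the residual. -/
theorem IsPrim.ae_eq_zero [CompleteSpace B] (hT : 0 < T) {f g : ℝ → B} (h : IsPrim T f g)
    (h0 : f =ᵐ[volume.restrict (Ioo 0 T)] 0) : g =ᵐ[volume.restrict (Ioo 0 T)] 0 :=
  ((h.hasWeakTimeDeriv hT).congr h0.symm Filter.EventuallyEq.rfl).unique
    ((IsPrim.const (0 : B)).hasWeakTimeDeriv hT)

theorem IsPrim.eq_zero_of_ae_eq_zero [CompleteSpace B] (hT : 0 < T) {f g : ℝ → B}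
    (h : IsPrim T f g) (h0 : f =ᵐ[volume.restrict (Ioo 0 T)] 0) : EqOn f 0 (Icc 0 T) :=
  eqOn_Icc_of_ae_eq hT h.continuousOn continuousOn_const h0

theorem MemL2Time.integrableOn {E : Type*} [NormedAddCommGroup E] {f : ℝ → E} (h : MemL2Time T f) : IntegrableOn f (Ioo 0 T) :=
  MemLp.integrable one_le_two h

theorem IsPrim.memL2Time {f g : ℝ → B} (h : IsPrim T f g) :
    MemL2Time T f := by
  obtain ⟨C, hC⟩ := isCompact_Icc.exists_bound_of_continuousOn h.continuousOn
  refine MemLp.of_bound ((h.continuousOn.mono Ioo_subset_Icc_self).aestronglyMeasurable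
    measurableSet_Ioo) C ?_
  exact (ae_restrict_iff' measurableSet_Ioo).2
    (Filter.Eventually.of_forall fun t ht => hC t (Ioo_subset_Icc_self ht))

end TimeCalculus

/-! ### Volterra convolution with an integrable kernel. -/

section Convolution

variable {B C : Type*} [NormedAddCommGroup B] [NormedSpace ℝ B]
  [NormedAddCommGroup C] [NormedSpace ℝ C] {T : ℝ}

/-- The convolution `∫₀ᵗ k(t-s) f(s) ds`. -/
def volterra (k : ℝ → ℝ) (f : ℝ → B) (t : ℝ) : B := ∫ s in (0 : ℝ)..t, k (t - s) • f s

/-- The cutoff of `k` already forces `s < t`, so `f` only has to be cut at `0`. This turns the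
variable interval of integration into the whole line. -/
theorem indicator_smul_indicator {t : ℝ} (ht : t ≤ T) (k : ℝ → ℝ) (f : ℝ → B) (s : ℝ) :
    (Ioo 0 T).indicator k (t - s) • (Ioi 0).indicator f s =
      (Ioo 0 t).indicator (fun s => k (t - s) • f s) s := by
  by_cases h0 : 0 < s
  · by_cases h1 : s < t
    · have h2 : t - s ∈ Ioo 0 T := ⟨by linarith, by linarith⟩
      have h3 : s ∈ Ioo 0 t := ⟨h0, h1⟩
      rw [indicator_of_mem h2, indicator_of_mem (mem_Ioi.2 h0), indicator_of_mem h3]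
    · rw [indicator_of_notMem (fun h : t - s ∈ Ioo 0 T => h1 (by linarith [h.1])),
        indicator_of_notMem (fun h : s ∈ Ioo 0 t => h1 h.2), zero_smul]
  · rw [indicator_of_notMem (fun h : s ∈ Ioi 0 => h0 h),
      indicator_of_notMem (fun h : s ∈ Ioo 0 t => h0 h.1), smul_zero]

theorem volterra_eq_integral {t : ℝ} (h0 : 0 ≤ t) (ht : t ≤ T) (k : ℝ → ℝ) (f : ℝ → B) :
    volterra k f t = ∫ s, (Ioo 0 T).indicator k (t - s) • (Ioi 0).indicator f s := by
  simp_rw [indicator_smul_indicator ht]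
  rw [integral_indicator measurableSet_Ioo, volterra, intervalIntegral.integral_of_le h0,
    integral_Ioc_eq_integral_Ioo]

theorem volterra_congr {t : ℝ} (ht : t ∈ Icc 0 T) (k : ℝ → ℝ) {f f' : ℝ → B}
    (h : f =ᵐ[volume.restrict (Ioo 0 T)] f') : volterra k f t = volterra k f' t := by
  rw [volterra, volterra, intervalIntegral.integral_of_le ht.1,
    intervalIntegral.integral_of_le ht.1, integral_Ioc_eq_integral_Ioo,
    integral_Ioc_eq_integral_Ioo]
  refine integral_congr_ae ?_
  filter_upwards [ae_restrict_of_ae_restrict_of_subset (Ioo_subset_Ioo_right ht.2) h] with s hs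
  rw [hs]

/-- With both factors extended by zero to integrable functions on the line, the `L¹ * L¹` theory
gives existence for almost every `t` and integrability in `t`. -/
theorem volterra_eq_convolution {t : ℝ} (h0 : 0 ≤ t) (ht : t ≤ T) (k : ℝ → ℝ) (f : ℝ → B) :
    volterra k f t = convolution ((Ioo 0 T).indicator k) ((Ioo 0 T).indicator f)
      (ContinuousLinearMap.lsmul ℝ ℝ) volume t := by
  rw [convolution_lsmul_swap, volterra_eq_integral h0 ht]
  refine integral_congr_ae ?_
  have : ∀ᵐ s : ℝ, s ≠ T := by simp [ae_iff]
  filter_upwards [this] with s hs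
  by_cases hsT : s < T
  · congr 1
    simp [indicator, hsT]
  · have : T < s := lt_of_le_of_ne (not_lt.1 hsT) hs.symm
    rw [indicator_of_notMem (fun h : t - s ∈ Ioo 0 T => by linarith [h.1]), zero_smul, zero_smul]

theorem volterra_ae_integrable {k : ℝ → ℝ} {f : ℝ → B} (hk : IntegrableOn k (Ioo 0 T))
    (hf : IntegrableOn f (Ioo 0 T)) :
    ∀ᵐ t ∂(volume.restrict (Ioo 0 T)), IntegrableOn (fun s => k (t - s) • f s) (Ioc 0 t) := by
  have h := Integrable.ae_convolution_exists (ContinuousLinearMap.lsmul ℝ ℝ)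
    (hk.integrable_indicator measurableSet_Ioo) (hf.integrable_indicator measurableSet_Ioo)
  filter_upwards [ae_restrict_of_ae h, ae_restrict_mem measurableSet_Ioo] with t ht htT
  have h1 := (convolutionExistsAt_iff_integrable_swap).1 ht
  rw [integrableOn_Ioc_iff_integrableOn_Ioo]
  refine h1.integrableOn.congr_fun (fun s hs => ?_) measurableSet_Ioo
  simp only [ContinuousLinearMap.lsmul_apply]
  have h2 : t - s ∈ Ioo 0 T := ⟨by linarith [hs.2], by linarith [hs.1, htT.2]⟩
  have h3 : s ∈ Ioo 0 T := ⟨hs.1, hs.2.trans htT.2⟩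
  rw [indicator_of_mem h2, indicator_of_mem h3]

theorem volterra_integrableOn {k : ℝ → ℝ} {f : ℝ → B} (hk : IntegrableOn k (Ioo 0 T))
    (hf : IntegrableOn f (Ioo 0 T)) : IntegrableOn (volterra k f) (Ioo 0 T) := by
  have h := Integrable.integrable_convolution (ContinuousLinearMap.lsmul ℝ ℝ)
    (hk.integrable_indicator measurableSet_Ioo) (hf.integrable_indicator measurableSet_Ioo)
  exact h.integrableOn.congr_fun (fun t ht => (volterra_eq_convolution ht.1.le ht.2.le k f).symm)
    measurableSet_Ioo

/-- Only for almost every `t`: where the integrand is not integrable the left integral is `0` by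
convention, and `L` need not commute with it. -/
theorem clm_volterra_ae [CompleteSpace B] [CompleteSpace C] (L : B →L[ℝ] C) {k : ℝ → ℝ}
    {f : ℝ → B} (hk : IntegrableOn k (Ioo 0 T)) (hf : IntegrableOn f (Ioo 0 T)) :
    ∀ᵐ t ∂(volume.restrict (Ioo 0 T)), L (volterra k f t) = volterra k (fun s => L (f s)) t := by
  filter_upwards [volterra_ae_integrable hk hf, ae_restrict_mem measurableSet_Ioo] with t ht htT
  rw [volterra, volterra, intervalIntegral.integral_of_le htT.1.le,
    intervalIntegral.integral_of_le htT.1.le, ← L.integral_comp_comm ht]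
  simp

/-- Integrating a convolution amounts to integrating one of its factors. -/
theorem integral_volterra {k : ℝ → ℝ} {g : ℝ → B} (hk : IntegrableOn k (Ioo 0 T))
    (hg : IntegrableOn g (Ioo 0 T)) {t : ℝ} (ht : t ∈ Icc 0 T) :
    ∫ τ in Ioc 0 t, volterra k g τ = volterra k (fun s => ∫ r in (0 : ℝ)..s, g r) t := by
  set k' := (Ioo 0 T).indicator k with hk'
  set g' := (Ioo 0 T).indicator g with hg'
  have ik : Integrable k' := hk.integrable_indicator measurableSet_Ioo
  have ig : Integrable g' := hg.integrable_indicator measurableSet_Ioo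
  have h2 := Integrable.convolution_integrand (ContinuousLinearMap.lsmul ℝ ℝ) ik ig
  have h3 : Integrable (fun p : ℝ × ℝ => k' p.2 • g' (p.1 - p.2))
      ((volume.restrict (Ioc 0 t)).prod volume) := by
    have := h2.integrableOn (s := Ioc 0 t ×ˢ univ)
    rw [IntegrableOn, ← Measure.prod_restrict, Measure.restrict_univ] at this
    exact this
  have e1 : ∫ τ in Ioc 0 t, volterra k g τ = ∫ τ in Ioc 0 t, ∫ s, k' s • g' (τ - s) := by
    refine setIntegral_congr_fun measurableSet_Ioc fun τ hτ => ?_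
    rw [volterra_eq_convolution hτ.1.le (hτ.2.trans ht.2)]
    rfl
  -- After Fubini, the substitution `s ↦ t - s` puts the factor `k' (t - s)` on both sides, and it
  -- remains to compare the inner integrals of `g`.
  rw [e1, integral_integral_swap h3, volterra_eq_integral ht.1 ht.2,
    ← integral_sub_left_eq_self _ volume t]
  refine integral_congr_ae (Filter.Eventually.of_forall fun s => ?_)
  simp only
  rw [integral_smul]
  by_cases hs : t - s ∈ Ioo 0 T
  swap
  · rw [hk', indicator_of_notMem hs, zero_smul, zero_smul]
  congr 1
  -- As `g'` vanishes on the negative axis, the shifted window `(-(t - s), s]` leaves exactly the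
  -- integral of `g` from `0` to `s`, or zero if `s ≤ 0`.
  have e2 : ∫ τ in Ioc 0 t, g' (τ - (t - s)) = ∫ τ in Ioc (-(t - s)) s, g' τ := by
    have := intervalIntegral.integral_comp_sub_right (a := 0) (b := t) g' (t - s)
    rw [sub_sub_cancel, zero_sub] at this
    rwa [intervalIntegral.integral_of_le ht.1,
      intervalIntegral.integral_of_le (by linarith [ht.1])] at this
  rw [e2]
  by_cases h0 : 0 < s
  · rw [indicator_of_mem (mem_Ioi.2 h0), intervalIntegral.integral_of_le h0.le, hg',
      setIntegral_indicator measurableSet_Ioo]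
    congr 2
    ext x
    constructor
    · rintro ⟨h1, h2⟩
      exact ⟨h2.1, h1.2⟩
    · rintro ⟨h1, h2⟩
      exact ⟨⟨by linarith [hs.1], h2⟩, h1, by linarith [hs.1, ht.2]⟩
  · rw [indicator_of_notMem (by simpa using h0)]
    refine setIntegral_eq_zero_of_forall_eq_zero fun τ hτ => ?_
    exact indicator_of_notMem (fun h : τ ∈ Ioo 0 T => by linarith [h.1, hτ.2]) _

/-- Split `f = f 0 + ∫ g`. The constant part contributes the primitive of `k` times `f 0`; for the
rest `integral_volterra` moves the integration from `g` to the convolution. No derivative of `k`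
occurs. -/
theorem IsPrim.volterra [CompleteSpace B] {k : ℝ → ℝ} {f g : ℝ → B}
    (hk : IntegrableOn k (Ioo 0 T)) (h : IsPrim T f g) :
    IsPrim T (volterra k f) (fun t => k t • f 0 + volterra k g t) := by
  have hg := h.integrableOn
  have i1 : IntegrableOn (fun t => k t • f 0) (Ioo 0 T) := hk.smul_const _
  have i2 := volterra_integrableOn hk hg
  refine ⟨i1.add i2, fun t ht => ?_⟩
  have hp := (IsPrim.of_integrableOn hg 0).continuousOn
  simp only [zero_add] at hp
  have hkt : IntegrableOn (fun s => k (t - s)) (Ioc 0 t) := by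
    have := (integrableOn_Ioc_of_Ioo hk ht.2)
    rw [← intervalIntegrable_iff_integrableOn_Ioc_of_le ht.1] at this ⊢
    simpa using (this.comp_sub_left t).symm
  have hkt' : IntegrableOn (fun s => k (t - s) • ∫ r in (0 : ℝ)..s, g r) (Ioc 0 t) := by
    rw [integrableOn_Ioc_iff_integrableOn_Ioo, ← integrableOn_Icc_iff_integrableOn_Ioo] at *
    exact hkt.smul_continuousOn (hp.mono (Icc_subset_Icc_right ht.2)) isCompact_Icc
  have e : KelvinVoigt.volterra k f t = (∫ s in Ioc 0 t, k s) • f 0 +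
      KelvinVoigt.volterra k (fun s => ∫ r in (0 : ℝ)..s, g r) t := by
    have e2 : ∫ s in Ioc 0 t, k s = ∫ s in Ioc 0 t, k (t - s) := by
      rw [← intervalIntegral.integral_of_le ht.1, ← intervalIntegral.integral_of_le ht.1,
        intervalIntegral.integral_comp_sub_left]
      simp
    rw [e2, KelvinVoigt.volterra, KelvinVoigt.volterra, intervalIntegral.integral_of_le ht.1,
      intervalIntegral.integral_of_le ht.1, ← integral_smul_const,
      ← integral_add (hkt.smul_const _) hkt']
    refine setIntegral_congr_fun measurableSet_Ioc fun s hs => ?_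
    rw [h.eq_add s ⟨hs.1.le, hs.2.trans ht.2⟩, smul_add]
  have z : KelvinVoigt.volterra k f 0 = 0 := by simp [KelvinVoigt.volterra]
  rw [e, z, zero_add, intervalIntegral.integral_of_le ht.1,
    integral_add (integrableOn_Ioc_of_Ioo i1 ht.2) (integrableOn_Ioc_of_Ioo i2 ht.2),
    integral_smul_const, integral_volterra hk hg ht]

end Convolution

/-! ### Test functions in `H¹₀`. -/

section Density

variable {O : Set E3} {F : Type*} [NormedAddCommGroup F] [NormedSpace ℝ F]

theorem IsTestFunction.exists_H10 {ψ : E3 → F} (hψ : IsTestFunction O ψ) :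
    ∃ z : H10 O F, z.1.1 =ᵐ[volume.restrict O] ψ ∧ z.1.2 =ᵐ[volume.restrict O] fderiv ℝ ψ :=
  ⟨⟨(hψ.memLp.toLp, hψ.memLp_fderiv.toLp), (testGraph O F).le_topologicalClosure
    ⟨ψ, hψ, hψ.memLp.coeFn_toLp, hψ.memLp_fderiv.coeFn_toLp⟩⟩,
    hψ.memLp.coeFn_toLp, hψ.memLp_fderiv.coeFn_toLp⟩

/-- A closed condition on `H¹₀` holds if it holds for test functions. -/
theorem H10.induction {p : H10 O F → Prop} (hp : IsClosed {z | p z})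
    (h : ∀ (z : H10 O F) (ψ : E3 → F), IsTestFunction O ψ → z.1.1 =ᵐ[volume.restrict O] ψ →
      z.1.2 =ᵐ[volume.restrict O] fderiv ℝ ψ → p z) (z : H10 O F) : p z := by
  have hd : Dense {z : H10 O F | z.1 ∈ testGraph O F} := by
    rw [Subtype.dense_iff]
    refine Subset.trans subset_rfl (closure_mono ?_)
    exact fun q hq => ⟨⟨q, (testGraph O F).le_topologicalClosure hq⟩, hq, rfl⟩
  have : closure {z : H10 O F | z.1 ∈ testGraph O F} ⊆ {z | p z} := by
    refine closure_minimal ?_ hp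
    rintro z ⟨ψ, h1, h2, h3⟩
    exact h z ψ h1 h2 h3
  exact this (hd z)

/-- Both integrands vanish off `O`, so this is integration by parts on the whole space. -/
theorem IsTestFunction.isWeakFDeriv {ψ : E3 → F} (hψ : IsTestFunction O ψ) :
    IsWeakFDeriv O ψ (fderiv ℝ ψ) := by
  intro θ hθ w
  have hψ0 : ∀ x, x ∉ O → ψ x = 0 := fun x hx =>
    image_eq_zero_of_notMem_tsupport fun h => hx (hψ.support_subset h)
  have hθ0 : ∀ x, x ∉ O → θ x = 0 := fun x hx =>
    image_eq_zero_of_notMem_tsupport fun h => hx (hθ.support_subset h)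
  rw [setIntegral_eq_integral_of_forall_compl_eq_zero fun x hx => by rw [hψ0 x hx, smul_zero],
    setIntegral_eq_integral_of_forall_compl_eq_zero fun x hx => by rw [hθ0 x hx, zero_smul]]
  have cθ := hθ.smooth.continuous
  have cψ := hψ.smooth.continuous
  have dθ : Continuous fun x => fderiv ℝ θ x w :=
    (hθ.smooth.continuous_fderiv (by simp)).clm_apply continuous_const
  have dψ : Continuous fun x => fderiv ℝ ψ x w :=
    (hψ.smooth.continuous_fderiv (by simp)).clm_apply continuous_const
  rw [integral_smul_fderiv_eq_neg_fderiv_smul_of_integrable, neg_neg]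
  · exact (dθ.smul cψ).integrable_of_hasCompactSupport hψ.compact_support.smul_left
  · exact (cθ.smul dψ).integrable_of_hasCompactSupport hθ.compact_support.smul_right
  · exact (cθ.smul cψ).integrable_of_hasCompactSupport hθ.compact_support.smul_right
  · exact fun x _ => hθ.smooth.differentiable (by simp) x
  · exact fun x _ => hψ.smooth.differentiable (by simp) x

theorem testGraph_le_weakGraph : testGraph O F ≤ weakGraph O F := by
  rintro q ⟨ψ, hψ, h1, h2⟩ θ hθ w
  rw [integral_congr_ae (g := fun x => fderiv ℝ θ x w • ψ x), hψ.isWeakFDeriv θ hθ w]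
  · congr 1
    refine integral_congr_ae ?_
    filter_upwards [h2] with x hx
    rw [hx]
  · filter_upwards [h1] with x hx
    rw [hx]

theorem H10.isWeakFDeriv [CompleteSpace F] (z : H10 O F) : IsWeakFDeriv O z.1.1 z.1.2 :=
  (Submodule.topologicalClosure_minimal _ testGraph_le_weakGraph (isClosed_weakGraph O F)) z.2

end Density

/-! ### The embedding `H¹₀ ⊆ L⁴` and the space `L^{4/3}`. -/

section Sobolev

open ENNReal NNReal

variable {O : Set E3}

instance : Fact ((1 : ℝ≥0∞) ≤ 4) := ⟨by norm_num⟩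

theorem one_le_four_thirds : (1 : ℝ≥0∞) ≤ 4 / 3 :=
  (ENNReal.le_div_iff_mul_le (by simp) (by simp)).2 (by norm_num)

instance : Fact ((1 : ℝ≥0∞) ≤ 4 / 3) := ⟨one_le_four_thirds⟩

/-- `1/2 + 1/4 = 3/4`: a Jacobian in `L²` applied to a velocity in `L⁴` lies in `L^{4/3}`, whose
conjugate exponent is again `4`. -/
instance : ENNReal.HolderTriple 2 4 (4 / 3) where
  inv_add_inv_eq_inv := by
    rw [ENNReal.inv_div (by simp) (by simp)]
    refine (ENNReal.toReal_eq_toReal_iff' (by simp) (by simp [ENNReal.div_eq_top])).1 ?_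
    rw [ENNReal.toReal_add (by simp) (by simp)]
    norm_num

instance : ENNReal.HolderConjugate (4 / 3) 4 where
  inv_add_inv_eq_inv := by
    rw [ENNReal.inv_div (by simp) (by simp)]
    refine (ENNReal.toReal_eq_toReal_iff' (by simp [ENNReal.div_eq_top]) (by simp)).1 ?_
    rw [ENNReal.toReal_add (by simp [ENNReal.div_eq_top]) (by simp)]
    norm_num

instance : ENNReal.HolderTriple 4 (4 / 3) 1 :=
  ENNReal.HolderTriple.symm (p := 4 / 3) (q := 4)

/-- The embedding `H¹₀ ⊆ L⁴` on bounded sets. -/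
theorem H10.exists_eLpNorm_four_le (hO : Bornology.IsBounded O) :
    ∃ C : ℝ≥0, ∀ z : H10 O E3, eLpNorm z.1.1 4 (volume.restrict O) ≤ ENNReal.ofReal (C * ‖z‖) := by
  set C := eLpNormLESNormFDerivOfLeConst E3 (volume : Measure E3) O 2 4
  have htest : ∀ q ∈ testGraph O E3,
      eLpNorm q.1 4 (volume.restrict O) ≤ ENNReal.ofReal (C * ‖q‖) := by
    rintro q ⟨ψ, hψ, h1, h2⟩
    have hs : Function.support ψ ⊆ O := (subset_tsupport ψ).trans hψ.support_subset
    have hs' : Function.support (fderiv ℝ ψ) ⊆ O :=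
      ((subset_tsupport _).trans (tsupport_fderiv_subset ℝ)).trans hψ.support_subset
    -- Gagliardo–Nirenberg–Sobolev on a bounded set, admissible because `1/2 - 1/3 ≤ 1/4`.
    have key := eLpNorm_le_eLpNorm_fderiv_of_le (volume : Measure E3) (u := ψ) (s := O)
      (p := 2) (q := 4) (hψ.smooth.of_le (by simp)) hs (by norm_num)
      (by simp; norm_num) (by simp; norm_num) hO
    have e2 : eLpNorm (fderiv ℝ ψ) 2 volume = eLpNorm q.2 2 (volume.restrict O) := by
      rw [eLpNorm_congr_ae h2, eLpNorm_restrict_eq_of_support_subset (ε := E3 →L[ℝ] E3) hs']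
    calc eLpNorm q.1 4 (volume.restrict O) = eLpNorm ψ 4 (volume.restrict O) :=
          eLpNorm_congr_ae h1
      _ ≤ eLpNorm ψ 4 volume := eLpNorm_mono_measure _ Measure.restrict_le_self
      _ ≤ C * eLpNorm q.2 2 (volume.restrict O) := by
          rw [← e2]; exact_mod_cast key
      _ ≤ ENNReal.ofReal (C * ‖q‖) := by
          rw [ENNReal.ofReal_mul C.coe_nonneg, ENNReal.ofReal_coe_nnreal]
          gcongr
          rw [← Lp.enorm_def, ← ofReal_norm]
          exact ENNReal.ofReal_le_ofReal (norm_snd_le q)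
  refine ⟨C, fun z => ?_⟩
  obtain ⟨q, hq, hlim⟩ := mem_closure_iff_seq_limit.1 z.2
  have hlim1 : Filter.Tendsto (fun n => (q n).1) Filter.atTop (nhds z.1.1) :=
    (continuous_fst.tendsto _).comp hlim
  -- Membership of the limit in `L⁴` is not known beforehand; an almost everywhere convergent
  -- subsequence and Fatou's lemma carry the bound over.
  obtain ⟨ns, hns, hae⟩ := (tendstoInMeasure_of_tendsto_Lp hlim1).exists_seq_tendsto_ae
  refine (Lp.eLpNorm_lim_le_liminf_eLpNorm (fun n => Lp.aestronglyMeasurable (q (ns n)).1)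
    _ hae).trans ?_
  have hb : Filter.Tendsto (fun n => ENNReal.ofReal (C * ‖q (ns n)‖)) Filter.atTop
      (nhds (ENNReal.ofReal (C * ‖z‖))) :=
    ENNReal.tendsto_ofReal (((hlim.norm).comp hns.tendsto_atTop).const_mul _)
  rw [← hb.liminf_eq]
  exact Filter.liminf_le_liminf (Filter.Eventually.of_forall fun n => htest _ (hq _))

instance [h : Fact (Bornology.IsBounded O)] :
    IsFiniteMeasure ((volume : Measure E3).restrict O) :=
  ⟨by rw [Measure.restrict_apply_univ]; exact h.out.measure_lt_top⟩

variable [hOb : Fact (Bornology.IsBounded O)]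

theorem H10.memLp_four (z : H10 O E3) : MemLp z.1.1 4 (volume.restrict O) := by
  obtain ⟨C, hC⟩ := H10.exists_eLpNorm_four_le hOb.out
  exact ⟨Lp.aestronglyMeasurable _, (hC z).trans_lt ENNReal.ofReal_lt_top⟩

variable (O) in
/-- The embedding `H¹₀ ⊆ L⁴` on bounded sets. -/
def toL4 : H10 O E3 →L[ℝ] Lp E3 4 ((volume : Measure E3).restrict O) :=
  LinearMap.mkContinuousOfExistsBound
    { toFun := fun z => z.memLp_four.toLp
      map_add' := fun a b => by
        rw [← MemLp.toLp_add]
        exact MemLp.toLp_congr _ _ (Lp.coeFn_add a.1.1 b.1.1)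
      map_smul' := fun c a => by
        rw [RingHom.id_apply, ← MemLp.toLp_const_smul]
        exact MemLp.toLp_congr _ _ (Lp.coeFn_smul c a.1.1) }
    (by
      obtain ⟨C, hC⟩ := H10.exists_eLpNorm_four_le hOb.out
      refine ⟨C, fun z => ?_⟩
      rw [LinearMap.coe_mk, AddHom.coe_mk, Lp.norm_toLp]
      exact ENNReal.toReal_le_of_le_ofReal (by positivity) (hC z))

theorem coeFn_toL4 (z : H10 O E3) : toL4 O z =ᵐ[volume.restrict O] z.1.1 :=
  z.memLp_four.coeFn_toLp

variable (O) in
/-- `L^{4/3}(O; ℝ³)`, the space in which the momentum equation takes place. -/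
abbrev L43 : Type := Lp E3 (4 / 3) ((volume : Measure E3).restrict O)

variable (O) in
/-- The inclusion `L² ⊆ L^{4/3}`. -/
def inclL : L2 O E3 →L[ℝ] L43 O :=
  -- Hölder multiplication by the constant `1`, which is in `L⁴` because `O` has finite measure.
  ((ContinuousLinearMap.lsmul ℝ ℝ).flip.holderL (volume.restrict O) 2 4 (4 / 3)).flip
    (memLp_const (1 : ℝ)).toLp

theorem coeFn_inclL (f : L2 O E3) : inclL O f =ᵐ[volume.restrict O] f := by
  refine (ContinuousLinearMap.coeFn_holder _ _ _).trans ?_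
  filter_upwards [(memLp_const (μ := (volume : Measure E3).restrict O) (p := 4) (1 : ℝ)).coeFn_toLp]
    with x hx
  rw [hx]
  simp

variable (O) in
/-- The duality pairing between `L^{4/3}` and `H¹₀`. -/
def dualL : L43 O →L[ℝ] H10 O E3 →L[ℝ] ℝ :=
  (((innerSL ℝ : E3 →L[ℝ] E3 →L[ℝ] ℝ).lpPairing (volume.restrict O) (4 / 3) 4).flip.comp
    (toL4 O)).flip

theorem dualL_apply (f : L43 O) (z : H10 O E3) :
    dualL O f z = ∫ x in O, inner ℝ (f x) (z.1.1 x) := by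
  change (innerSL ℝ : E3 →L[ℝ] E3 →L[ℝ] ℝ).lpPairing (volume.restrict O) (4 / 3) 4 f (toL4 O z) = _
  rw [ContinuousLinearMap.lpPairing_eq_integral]
  refine integral_congr_ae ?_
  filter_upwards [coeFn_toL4 z] with x hx
  rw [hx]
  rfl

/-- Bridge from the integrals in the problem statements to a bounded bilinear form. -/
theorem pairing_eq_dualL {f g : E3 → E3} {F : L43 O} {z : H10 O E3}
    (hf : f =ᵐ[volume.restrict O] F) (hg : g =ᵐ[volume.restrict O] z.1.1) :
    pairing O f g = dualL O F z := by
  rw [dualL_apply, pairing]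
  refine integral_congr_ae ?_
  filter_upwards [hf, hg] with x h1 h2
  rw [h1, h2]

variable (O) in
/-- The convective term `(a · ∇) b`, as a bilinear map in `a` and the Jacobian of `b`. -/
def convectL : H10 O E3 →L[ℝ] L2 O (E3 →L[ℝ] E3) →L[ℝ] L43 O :=
  ((ContinuousLinearMap.id ℝ (E3 →L[ℝ] E3)).holderL (volume.restrict O) 2 4 (4 / 3)).flip.comp
    (toL4 O)

theorem coeFn_convectL (a : H10 O E3) (J : L2 O (E3 →L[ℝ] E3)) :
    convectL O a J =ᵐ[volume.restrict O] fun x => J x (a.1.1 x) := by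
  refine (ContinuousLinearMap.coeFn_holder _ _ _).trans ?_
  filter_upwards [coeFn_toL4 a] with x hx
  exact congrArg (J x) hx

/-- Test functions separate the points of `L^{4/3}`. -/
theorem L43.eq_zero_of_forall_test (hO : IsOpen O) (f : L43 O)
    (h : ∀ ψ : E3 → E3, IsTestFunction O ψ → pairing O f ψ = 0) : f = 0 := by
  have hi : Integrable f (volume.restrict O) := (Lp.memLp f).integrable one_le_four_thirds
  rw [Lp.eq_zero_iff_ae_eq_zero]
  refine (ae_restrict_iff' hO.measurableSet).2 ?_
  refine hO.ae_eq_zero_of_integral_contDiff_smul_eq_zero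
    (IntegrableOn.locallyIntegrableOn hi) fun θ h1 h2 h3 => ?_
  have hθ : IsTestFunction O θ := ⟨h1, h2, h3⟩
  have hi' : Integrable (fun x => θ x • f x) (volume.restrict O) :=
    memLp_one_iff_integrable.1 ((Lp.memLp f).smul
      ((h1.continuous.memLp_of_hasCompactSupport h2 (p := 4)).restrict O))
  rw [← setIntegral_eq_integral_of_forall_compl_eq_zero (s := O) fun x hx => by
    rw [image_eq_zero_of_notMem_tsupport fun h => hx (h3 h), zero_smul]]
  -- The vector integral is tested direction by direction; `θ • w` is an admissible test field.
  refine ext_inner_left ℝ fun w => ?_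
  rw [inner_zero_right, ← integral_inner hi']
  rw [← h (fun x => θ x • w) ⟨h1.smul contDiff_const, h2.smul_right,
    (tsupport_smul_subset_left θ _).trans h3⟩, pairing]
  refine integral_congr_ae (Filter.Eventually.of_forall fun x => ?_)
  simp only [inner_smul_right, real_inner_comm]

end Sobolev

/-! ### The differential operators as bounded linear maps. -/

section Operators

variable (O : Set E3)

/-- The velocity as a continuous linear map. -/
def velL : H2H10 O →L[ℝ] L2 O E3 :=
  ((ContinuousLinearMap.fst ℝ _ _).comp (ContinuousLinearMap.fst ℝ _ _)).comp
    (H2H10Submodule O E3).subtypeL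

/-- The Jacobian as a continuous linear map. -/
def jacL : H2H10 O →L[ℝ] L2 O (E3 →L[ℝ] E3) :=
  ((ContinuousLinearMap.snd ℝ _ _).comp (ContinuousLinearMap.fst ℝ _ _)).comp
    (H2H10Submodule O E3).subtypeL

/-- The inclusion `H¹₀ ∩ H² ⊆ H¹₀` as a continuous linear map. -/
def toH10L : H2H10 O →L[ℝ] H10 O E3 :=
  ((ContinuousLinearMap.fst ℝ _ _).comp (H2H10Submodule O E3).subtypeL).codRestrict _
    fun a => a.2.1

/-- The Laplacian as a continuous linear map. -/
def lapL : H2H10 O →L[ℝ] L2 O E3 :=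
  ∑ i : Fin 3,
    ((ContinuousLinearMap.apply ℝ E3 (basisVec i)).compLpL 2 (volume.restrict O)).comp
      (((ContinuousLinearMap.apply ℝ (E3 →L[ℝ] E3) (basisVec i)).compLpL 2
        (volume.restrict O)).comp
          ((ContinuousLinearMap.snd ℝ _ _).comp (H2H10Submodule O E3).subtypeL))

/-- The divergence of a matrix as a continuous linear map. -/
def divOfL : (E3 →L[ℝ] E3) →L[ℝ] ℝ :=
  ∑ i : Fin 3, (EuclideanSpace.proj i).comp (ContinuousLinearMap.apply ℝ E3 (basisVec i))

/-- The divergence as a continuous linear map. -/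
def divL : L2 O (E3 →L[ℝ] E3) →L[ℝ] L2 O ℝ := divOfL.compLpL 2 (volume.restrict O)

/-- The Riesz isomorphism from functionals to vectors. -/
def rieszL : (E3 →L[ℝ] ℝ) →L[ℝ] E3 :=
  LinearMap.mkContinuous
    { toFun := (InnerProductSpace.toDual ℝ E3).symm
      map_add' := map_add _
      map_smul' := fun c L => by simp } 1 fun L => by simp

/-- The gradient of a scalar `H¹` function as a continuous linear map. -/
def gradL : H1 O ℝ →L[ℝ] L2 O E3 :=
  (rieszL.compLpL 2 (volume.restrict O)).comp
    ((ContinuousLinearMap.snd ℝ _ _).comp (weakGraph O ℝ).subtypeL)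

theorem abs_frob_le (A B : E3 →L[ℝ] E3) : ‖frob A B‖ ≤ 3 * ‖A‖ * ‖B‖ := by
  have h : ∀ i : Fin 3, ‖(inner ℝ (A (basisVec i)) (B (basisVec i)) : ℝ)‖ ≤ ‖A‖ * ‖B‖ := by
    intro i
    have hn : ‖basisVec i‖ = 1 := by simp
    have h1 := A.le_opNorm (basisVec i)
    have h2 := B.le_opNorm (basisVec i)
    rw [hn, mul_one] at h1 h2
    exact (norm_inner_le_norm _ _).trans (mul_le_mul h1 h2 (norm_nonneg _) (norm_nonneg _))
  calc ‖frob A B‖ ≤ ∑ _i : Fin 3, ‖A‖ * ‖B‖ := norm_sum_le_of_le _ fun i _ => h i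
    _ = 3 * ‖A‖ * ‖B‖ := by simp [mul_assoc]

/-- The Frobenius product as a continuous bilinear map. -/
def frobL : (E3 →L[ℝ] E3) →L[ℝ] (E3 →L[ℝ] E3) →L[ℝ] ℝ :=
  LinearMap.mkContinuous₂ (LinearMap.mk₂ ℝ frob
    (fun A A' B => by simp [frob, inner_add_left, Finset.sum_add_distrib])
    (fun c A B => by simp [frob, inner_smul_left, Finset.mul_sum])
    (fun A B B' => by simp [frob, inner_add_right, Finset.sum_add_distrib])
    (fun c A B => by simp [frob, inner_smul_right, Finset.mul_sum])) 3 abs_frob_le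

/-- The `L²` Frobenius product of Jacobians. -/
def frobPairL : L2 O (E3 →L[ℝ] E3) →L[ℝ] L2 O (E3 →L[ℝ] E3) →L[ℝ] ℝ :=
  frobL.lpPairing (volume.restrict O) 2 2

variable {O}

@[simp] theorem velL_apply (a : H2H10 O) : velL O a = vel a := rfl

@[simp] theorem lapL_apply (a : H2H10 O) : lapL O a = lap a := by
  rw [lapL, _root_.sum_apply]
  rfl

theorem coeFn_gradL (p : H1 O ℝ) : gradL O p =ᵐ[volume.restrict O] gradVec p :=
  ContinuousLinearMap.coeFn_compLpL _ _

@[simp] theorem divOfL_apply (A : E3 →L[ℝ] E3) : divOfL A = divOf A := by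
  simp [divOfL, divOf]

theorem divL_eq_zero_iff (J : L2 O (E3 →L[ℝ] E3)) : divL O J = 0 ↔ DivFree J := by
  rw [Lp.eq_zero_iff_ae_eq_zero, DivFree]
  have h := ContinuousLinearMap.coeFn_compLpL (p := 2) divOfL J
  constructor
  · intro h'
    filter_upwards [h, h'] with x h1 h2
    rw [← divOfL_apply, ← h1]
    exact h2
  · intro h'
    filter_upwards [h, h'] with x h1 h2
    exact h1.trans ((divOfL_apply _).trans h2)

@[simp] theorem frobL_apply (A B : E3 →L[ℝ] E3) : frobL A B = frob A B := rfl

theorem frobPairL_apply (J K : L2 O (E3 →L[ℝ] E3)) :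
    frobPairL O J K = ∫ x in O, frob (J x) (K x) := by
  simp [frobPairL, ContinuousLinearMap.lpPairing_eq_integral]

theorem frobPairL_comm (J K : L2 O (E3 →L[ℝ] E3)) : frobPairL O J K = frobPairL O K J := by
  rw [frobPairL_apply, frobPairL_apply]
  simp only [frob, real_inner_comm]

theorem coeFn_lap (a : H2H10 O) : lap a =ᵐ[volume.restrict O]
    fun x => ∑ i : Fin 3, a.1.2 x (basisVec i) (basisVec i) := by
  have h : ∀ᵐ x ∂(volume.restrict O), ∀ i : Fin 3,
      applyDir (basisVec i) (applyDir (basisVec i) a.1.2) x =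
        a.1.2 x (basisVec i) (basisVec i) := by
    rw [ae_all_iff]
    intro i
    filter_upwards [(ContinuousLinearMap.apply ℝ E3 (basisVec i)).coeFn_compLpL
      (p := 2) (applyDir (basisVec i) a.1.2),
      ContinuousLinearMap.coeFn_compLpL (𝕜 := ℝ) (𝕜' := ℝ) (σ := RingHom.id ℝ)
        (E := E3 →L[ℝ] E3 →L[ℝ] E3) (F := E3 →L[ℝ] E3) (p := 2)
        (ContinuousLinearMap.apply ℝ (E3 →L[ℝ] E3) (basisVec i)) a.1.2] with x h1 h2
    exact h1.trans (congrArg (fun A : E3 →L[ℝ] E3 => A (basisVec i)) h2)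
  rw [lap, Fin.sum_univ_three]
  filter_upwards [h, Lp.coeFn_add (applyDir (basisVec 0) (applyDir (basisVec 0) a.1.2) +
    applyDir (basisVec 1) (applyDir (basisVec 1) a.1.2))
    (applyDir (basisVec 2) (applyDir (basisVec 2) a.1.2)),
    Lp.coeFn_add (applyDir (basisVec 0) (applyDir (basisVec 0) a.1.2))
      (applyDir (basisVec 1) (applyDir (basisVec 1) a.1.2))] with x h1 h2 h3
  rw [h2, Pi.add_apply, h3, Pi.add_apply, h1, h1, h1, Fin.sum_univ_three]

end Operators

/-! ### Integration by parts against test functions. -/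

section IntegrationByParts

variable {O : Set E3} {F G : Type*} [NormedAddCommGroup F] [NormedSpace ℝ F]
  [NormedAddCommGroup G] [NormedSpace ℝ G]

theorem IsTestFunction.clm_comp {ψ : E3 → F} (hψ : IsTestFunction O ψ) (L : F →L[ℝ] G) :
    IsTestFunction O (fun x => L (ψ x)) := by
  refine ⟨L.contDiff.comp hψ.smooth, hψ.compact_support.comp_left (map_zero L), ?_⟩
  exact (closure_mono (Function.support_comp_subset (map_zero L) ψ)).trans hψ.support_subset

theorem IsTestFunction.fderiv_clm_comp {ψ : E3 → F} (hψ : IsTestFunction O ψ) (L : F →L[ℝ] G)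
    (x w : E3) : fderiv ℝ (fun x => L (ψ x)) x w = L (fderiv ℝ ψ x w) := by
  have h := (L.hasFDerivAt).comp x (hψ.smooth.differentiable (by simp) x).hasFDerivAt
  change fderiv ℝ (L ∘ ψ) x w = _
  rw [h.fderiv]
  rfl

/-- Reduces vector identities to scalar components; the integrability claims permit summing over
components under the integral. -/
theorem IsWeakFDeriv.integral_clm [CompleteSpace F] {f : L2 O F} {g : L2 O (E3 →L[ℝ] F)}
    (h : IsWeakFDeriv O f g) (L : F →L[ℝ] ℝ) {θ : E3 → ℝ} (hθ : IsTestFunction O θ) (w : E3) :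
    Integrable (fun x => fderiv ℝ θ x w * L (f x)) (volume.restrict O) ∧
    Integrable (fun x => θ x * L (g x w)) (volume.restrict O) ∧
    ∫ x in O, fderiv ℝ θ x w * L (f x) = - ∫ x in O, θ x * L (g x w) := by
  have e1 : Integrable (fun x => (fderiv ℝ θ x w) • f x) (volume.restrict O) :=
    memLp_one_iff_integrable.1 ((Lp.memLp f).smul (hθ.memLp_fderiv_apply w))
  have e2 : Integrable (fun x => θ x • g x w) (volume.restrict O) :=
    memLp_one_iff_integrable.1
      (((ContinuousLinearMap.apply ℝ F w).comp_memLp' (Lp.memLp g)).smul hθ.memLp)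
  have := congrArg L (h θ hθ w)
  rw [map_neg, ← L.integral_comp_comm e1, ← L.integral_comp_comm e2] at this
  refine ⟨?_, ?_, ?_⟩
  · simpa using L.integrable_comp e1
  · simpa using L.integrable_comp e2
  · simpa using this

theorem sum_smul_basisVec (y : E3) : ∑ i : Fin 3, y i • basisVec i = y := by
  ext j
  simp [Finset.sum_apply, Pi.single_apply]

theorem clm_eq_sum (L : E3 →L[ℝ] F) (y : E3) : L y = ∑ i : Fin 3, y i • L (basisVec i) := by
  conv_lhs => rw [← sum_smul_basisVec y, map_sum]
  simp

theorem inner_eq_sum (x y : E3) : inner ℝ x y = ∑ j : Fin 3, y j * x j := by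
  simp [PiLp.inner_apply]

/-- The second derivative is the weak derivative of the Jacobian: apply this to each entry `∂ᵢaⱼ`
with test function `ψⱼ` and direction `i`, then sum. -/
theorem pairing_lap_test (a : H2H10 O) {ψ : E3 → E3} (hψ : IsTestFunction O ψ) :
    pairing O (lap a) ψ = - ∫ x in O, frob (jac a x) (fderiv ℝ ψ x) := by
  have key := fun i j : Fin 3 => IsWeakFDeriv.integral_clm (f := jac a) (g := a.1.2) a.2.2
    ((EuclideanSpace.proj j : E3 →L[ℝ] ℝ).comp (ContinuousLinearMap.apply ℝ E3 (basisVec i)))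
    (hψ.clm_comp (EuclideanSpace.proj j : E3 →L[ℝ] ℝ)) (basisVec i)
  simp only [hψ.fderiv_clm_comp] at key
  simp only [ContinuousLinearMap.comp_apply, ContinuousLinearMap.apply_apply,
    PiLp.proj_apply] at key
  have e1 : pairing O (lap a) ψ = ∫ x in O, ∑ i : Fin 3, ∑ j : Fin 3,
      ψ x j * (a.1.2 x (basisVec i) (basisVec i)) j := by
    refine integral_congr_ae ?_
    filter_upwards [coeFn_lap a] with x hx
    rw [hx, sum_inner]
    simp only [inner_eq_sum]
  have e2 : ∫ x in O, frob (jac a x) (fderiv ℝ ψ x) = ∫ x in O, ∑ i : Fin 3, ∑ j : Fin 3,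
      (fderiv ℝ ψ x (basisVec i)) j * (jac a x (basisVec i)) j := by
    simp only [frob, inner_eq_sum]
  rw [e1, e2, integral_finsetSum _ fun i _ => integrable_finsetSum _ fun j _ => (key i j).2.1,
    integral_finsetSum _ fun i _ => integrable_finsetSum _ fun j _ => (key i j).1,
    ← Finset.sum_neg_distrib]
  refine Finset.sum_congr rfl fun i _ => ?_
  rw [integral_finsetSum _ fun j _ => (key i j).2.1, integral_finsetSum _ fun j _ => (key i j).1,
    ← Finset.sum_neg_distrib]
  exact Finset.sum_congr rfl fun j _ => by rw [(key i j).2.2, neg_neg]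

theorem pairing_gradVec_test (p : H1 O ℝ) {ψ : E3 → E3} (hψ : IsTestFunction O ψ) :
    pairing O (gradVec p) ψ = - ∫ x in O, p.1.1 x * divOf (fderiv ℝ ψ x) := by
  have key := fun i : Fin 3 => IsWeakFDeriv.integral_clm (f := p.1.1) (g := p.1.2) p.2
    (ContinuousLinearMap.id ℝ ℝ) (hψ.clm_comp (EuclideanSpace.proj i : E3 →L[ℝ] ℝ)) (basisVec i)
  simp only [hψ.fderiv_clm_comp] at key
  simp only [ContinuousLinearMap.id_apply, PiLp.proj_apply] at key
  have e1 : pairing O (gradVec p) ψ = ∫ x in O, ∑ i : Fin 3, ψ x i * p.1.2 x (basisVec i) := by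
    refine integral_congr_ae (Filter.Eventually.of_forall fun x => ?_)
    simp only [gradVec, InnerProductSpace.toDual_symm_apply]
    rw [clm_eq_sum (p.1.2 x) (ψ x)]
    simp
  have e2 : ∫ x in O, p.1.1 x * divOf (fderiv ℝ ψ x) =
      ∫ x in O, ∑ i : Fin 3, (fderiv ℝ ψ x (basisVec i)) i * p.1.1 x := by
    simp only [divOf, Finset.mul_sum, mul_comm]
  rw [e1, e2, integral_finsetSum _ fun i _ => (key i).2.1, integral_finsetSum _ fun i _ => (key i).1,
    ← Finset.sum_neg_distrib]
  exact Finset.sum_congr rfl fun i _ => by rw [(key i).2.2, neg_neg]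

/-- A divergence free field is orthogonal to gradients of test functions. -/
theorem integral_fderiv_eq_zero_of_divFree (a : H10 O E3) (ha : DivFree a.1.2) {θ : E3 → ℝ}
    (hθ : IsTestFunction O θ) : ∫ x in O, fderiv ℝ θ x (a.1.1 x) = 0 := by
  have key := fun i : Fin 3 => a.isWeakFDeriv.integral_clm
    (EuclideanSpace.proj i : E3 →L[ℝ] ℝ) hθ (basisVec i)
  have e1 : ∫ x in O, fderiv ℝ θ x (a.1.1 x) =
      ∫ x in O, ∑ i : Fin 3, fderiv ℝ θ x (basisVec i) * (EuclideanSpace.proj i : E3 →L[ℝ] ℝ) (a.1.1 x) := by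
    refine integral_congr_ae (Filter.Eventually.of_forall fun x => ?_)
    simp only
    rw [clm_eq_sum (fderiv ℝ θ x) (a.1.1 x)]
    simp [mul_comm]
  rw [e1, integral_finsetSum _ fun i _ => (key i).1, Finset.sum_congr rfl fun i _ => (key i).2.2,
    Finset.sum_neg_distrib, ← integral_finsetSum _ fun i _ => (key i).2.1, neg_eq_zero]
  refine integral_eq_zero_of_ae ?_
  filter_upwards [ha] with x hx
  rw [← Finset.mul_sum]
  have : ∑ i : Fin 3, (EuclideanSpace.proj i : E3 →L[ℝ] ℝ) (a.1.2 x (basisVec i)) = 0 := hx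
  rw [this, mul_zero]
  rfl

end IntegrationByParts

/-! ### Symmetry, skew-symmetry and orthogonality on `H¹₀`. -/

section Duality

variable {O : Set E3} [hOb : Fact (Bornology.IsBounded O)]

theorem dualL_inclL (f : L2 O E3) (z : H10 O E3) : dualL O (inclL O f) z = inner ℝ f z.1.1 := by
  rw [dualL_apply, L2.inner_def]
  refine integral_congr_ae ?_
  filter_upwards [coeFn_inclL f] with x hx
  rw [hx]

theorem pairing_coe_eq_dualL (f : L2 O E3) {g : E3 → E3} {z : H10 O E3}
    (hg : g =ᵐ[volume.restrict O] z.1.1) : pairing O f g = dualL O (inclL O f) z :=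
  pairing_eq_dualL (coeFn_inclL f).symm hg

/-- Green's formula. Both sides are continuous in `z` for the `H¹` norm, so it passes from test
functions to `H¹₀` without a boundary term. -/
theorem dualL_lap (a : H2H10 O) (z : H10 O E3) :
    dualL O (inclL O (lap a)) z = - frobPairL O (jac a) z.1.2 := by
  refine H10.induction (p := fun z => dualL O (inclL O (lap a)) z = - frobPairL O (jac a) z.1.2)
    (isClosed_eq (dualL O (inclL O (lap a))).continuous
      ((frobPairL O (jac a)).continuous.comp
        (continuous_snd.comp continuous_subtype_val)).neg) ?_ z
  intro z ψ hψ h1 h2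
  rw [← pairing_coe_eq_dualL (lap a) h1.symm, pairing_lap_test a hψ, frobPairL_apply]
  congr 1
  refine integral_congr_ae ?_
  filter_upwards [h2] with x hx
  rw [hx]

/-- The Laplacian is symmetric on `H¹₀ ∩ H²`. -/
theorem dualL_lap_comm (a b : H2H10 O) :
    dualL O (inclL O (lap a)) (toH10 b) = dualL O (inclL O (lap b)) (toH10 a) := by
  rw [dualL_lap, dualL_lap, neg_inj]
  exact frobPairL_comm _ _

/-- Pressure gradients are orthogonal to divergence free fields in `H¹₀`. -/
theorem dualL_gradL (p : H1 O ℝ) (z : H10 O E3) (hz : DivFree z.1.2) :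
    dualL O (inclL O (gradL O p)) z = 0 := by
  -- The identity is proved for all of `H¹₀` before using `hz`, since the approximating test fields
  -- need not be divergence free.
  have key : ∀ z : H10 O E3,
      dualL O (inclL O (gradL O p)) z = - inner ℝ (divL O z.1.2) p.1.1 := by
    refine H10.induction (isClosed_eq (dualL O _).continuous ?_) ?_
    · exact (((divL O).continuous.comp
        (continuous_snd.comp continuous_subtype_val)).inner continuous_const).neg
    · intro z ψ hψ h1 h2
      rw [← pairing_eq_dualL ((coeFn_gradL p).symm.trans (coeFn_inclL _).symm) h1.symm,
        pairing_gradVec_test p hψ, L2.inner_def]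
      congr 1
      refine integral_congr_ae ?_
      filter_upwards [h2, ContinuousLinearMap.coeFn_compLpL (p := 2) divOfL z.1.2] with x h3 h4
      change _ = inner ℝ (divOfL.compLpL 2 (volume.restrict O) z.1.2 x) _
      rw [h4, h3]
      simp [mul_comm]
  rw [key, (divL_eq_zero_iff _).2 hz, inner_zero_left, neg_zero]

/-- The trilinear convective form is skew-symmetric for a divergence free transport field. -/
theorem dualL_convectL_skew (a : H10 O E3) (ha : DivFree a.1.2) (b c : H10 O E3) :
    dualL O (convectL O a b.1.2) c = - dualL O (convectL O a c.1.2) b := by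
  have hc1 : ∀ b : H10 O E3, Continuous fun c : H10 O E3 => dualL O (convectL O a b.1.2) c :=
    fun b => (dualL O _).continuous
  have hc2 : ∀ b : H10 O E3, Continuous fun c : H10 O E3 => dualL O (convectL O a c.1.2) b :=
    fun b => ((dualL O).flip b).continuous.comp
      ((convectL O a).continuous.comp (continuous_snd.comp continuous_subtype_val))
  refine H10.induction (p := fun c => dualL O (convectL O a b.1.2) c =
    - dualL O (convectL O a c.1.2) b) (isClosed_eq (hc1 b) (hc2 b).neg) ?_ c
  intro c χ hχ h1 h2
  refine H10.induction (p := fun b => dualL O (convectL O a b.1.2) c =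
    - dualL O (convectL O a c.1.2) b) (isClosed_eq (hc2 c) (hc1 c).neg) ?_ b
  intro b ψ hψ h3 h4
  -- For test fields the two forms add up to `∫ a · ∇(ψ · χ)`, which vanishes because `a` is
  -- divergence free.
  have hθ : IsTestFunction O (fun x => (inner ℝ (ψ x) (χ x) : ℝ)) := by
    refine ⟨hψ.smooth.inner ℝ hχ.smooth, ?_, ?_⟩
    · exact hψ.compact_support.mono fun x hx h => hx (by simp [h])
    · refine (closure_mono ?_).trans hψ.support_subset
      exact fun x hx h => hx (by simp [h])
  have h0 := integral_fderiv_eq_zero_of_divFree a ha hθ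
  have hi : ∀ b c : H10 O E3, Integrable (fun x => (inner ℝ (convectL O a b.1.2 x) (c.1.1 x) : ℝ))
      (volume.restrict O) := by
    intro b c
    have := (innerSL ℝ : E3 →L[ℝ] E3 →L[ℝ] ℝ).memLp_of_bilin 1
      (Lp.memLp (convectL O a b.1.2)) c.memLp_four
    exact memLp_one_iff_integrable.1 this
  rw [← add_eq_zero_iff_eq_neg, dualL_apply, dualL_apply, ← integral_add (hi b c) (hi c b), ← h0]
  refine integral_congr_ae ?_
  filter_upwards [h1, h2, h3, h4, coeFn_convectL a b.1.2, coeFn_convectL a c.1.2]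
    with x h1 h2 h3 h4 h5 h6
  rw [h5, h6, h1, h2, h3, h4, fderiv_inner_apply ℝ (hψ.smooth.differentiable (by simp) x)
    (hχ.smooth.differentiable (by simp) x), real_inner_comm (ψ x), add_comm]

/-- Extends the resolvent equation to test elements of `H¹₀`, so that `V(0) - v₀` may itself be used
as a test field. -/
theorem IsResolvent.dualL {μ₁ : ℝ} {v : H10 O E3} {f : E3 → E3} (h : IsResolvent μ₁ v f)
    {F : L43 O} (hf : f =ᵐ[volume.restrict O] F) (z : H10 O E3) :
    dualL O (inclL O v.1.1) z + μ₁ * frobPairL O v.1.2 z.1.2 = dualL O F z := by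
  refine H10.induction (p := fun z => KelvinVoigt.dualL O (inclL O v.1.1) z +
    μ₁ * frobPairL O v.1.2 z.1.2 = KelvinVoigt.dualL O F z) (isClosed_eq
      ((KelvinVoigt.dualL O _).continuous.add (continuous_const.mul
        ((frobPairL O v.1.2).continuous.comp (continuous_snd.comp continuous_subtype_val))))
      (KelvinVoigt.dualL O F).continuous) ?_ z
  intro z ψ hψ h1 h2
  rw [← pairing_coe_eq_dualL v.1.1 h1.symm, ← pairing_eq_dualL hf h1.symm, ← h ψ hψ,
    frobPairL_apply]
  congr 2
  refine integral_congr_ae ?_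
  filter_upwards [h2] with x hx
  rw [hx]

/-- Both terms are nonnegative, so each vanishes. Elements of `H¹₀` are pairs, so the function and
its Jacobian are both shown to be zero. -/
theorem H10.eq_zero_of_energy {μ₁ : ℝ} (hμ₁ : 0 < μ₁) {z : H10 O E3}
    (h : dualL O (inclL O z.1.1) z + μ₁ * frobPairL O z.1.2 z.1.2 = 0) : z = 0 := by
  have hnn : ∀ A : E3 →L[ℝ] E3, 0 ≤ frob A A := fun A =>
    Finset.sum_nonneg fun i _ => real_inner_self_nonneg
  have h1 : 0 ≤ dualL O (inclL O z.1.1) z := by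
    rw [dualL_inclL]; exact real_inner_self_nonneg
  have h2 : 0 ≤ frobPairL O z.1.2 z.1.2 := by
    rw [frobPairL_apply]; exact integral_nonneg fun x => hnn _
  have h3 : frobPairL O z.1.2 z.1.2 = 0 := by
    nlinarith [mul_nonneg hμ₁.le h2]
  have h4 : dualL O (inclL O z.1.1) z = 0 := by simpa [h3] using h
  have h5 : z.1.1 = 0 := by
    rw [dualL_inclL] at h4
    exact inner_self_eq_zero.1 h4
  have h6 : z.1.2 = 0 := by
    rw [frobPairL_apply, integral_eq_zero_iff_of_nonneg (fun x => hnn _)] at h3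
    · rw [Lp.eq_zero_iff_ae_eq_zero]
      filter_upwards [h3] with x hx
      have h7 : ∀ i, z.1.2 x (basisVec i) = 0 := by
        intro i
        have := (Finset.sum_eq_zero_iff_of_nonneg
          fun i _ => real_inner_self_nonneg).1 hx i (Finset.mem_univ i)
        exact inner_self_eq_zero.1 this
      ext1 y
      rw [clm_eq_sum]
      simp [h7]
    · have := frobL.memLp_of_bilin 1 (Lp.memLp z.1.2) (Lp.memLp z.1.2)
      simpa using memLp_one_iff_integrable.1 this
  exact Subtype.ext (Prod.ext h5 h6)

end Duality

/-- A function determined by its weak derivative and its initial value. -/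
theorem HasWeakTimeDeriv.ae_eq_of_isPrim {B : Type*} [NormedAddCommGroup B] [NormedSpace ℝ B]
    [CompleteSpace B] {T : ℝ} (hT : 0 < T) {f g F G : ℝ → B} (h : HasWeakTimeDeriv T f g)
    (hF : IsPrim T F G) (hg : g =ᵐ[volume.restrict (Ioo 0 T)] G)
    (h0 : HasInitialValue T f (F 0)) : f =ᵐ[volume.restrict (Ioo 0 T)] F := by
  have hp := (h.congr (g' := G) Filter.EventuallyEq.rfl hg.symm).ae_eq_primitive hT
    hF.integrableOn h0
  filter_upwards [hp, ae_restrict_mem measurableSet_Ioo] with t ht htT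
  rw [ht, hF.eq_add t (Ioo_subset_Icc_self htT)]

/-! ### The weight functional and primitives in `H¹₀ ∩ H²`. -/

section

variable {O : Set E3} {T : ℝ}

theorem pairing_coe (f g : L2 O E3) : pairing O f g = inner ℝ f g := rfl

/-- The functional `a ↦ ∫_O (I - μ₁Δ)φ · a dx`. -/
def weightL (μ₁ : ℝ) (φ : H2H10 O) : H2H10 O →L[ℝ] ℝ :=
  (innerSL ℝ (vel φ - μ₁ • lap φ) : L2 O E3 →L[ℝ] ℝ).comp (velL O)

theorem pairing_weight (μ₁ : ℝ) (φ a : H2H10 O) :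
    pairing O (fun x => vel φ x - μ₁ • lap φ x) (vel a) = weightL μ₁ φ a := by
  change _ = (inner ℝ (vel φ - μ₁ • lap φ) (vel a) : ℝ)
  rw [← pairing_coe, pairing, pairing]
  refine integral_congr_ae ?_
  filter_upwards [Lp.coeFn_sub (vel φ) (μ₁ • lap φ), Lp.coeFn_smul μ₁ (lap φ)] with x h1 h2
  rw [h1, Pi.sub_apply, h2, Pi.smul_apply]

theorem isPrim_primitive (u₀ : H2H10 O) {v : ℝ → H2H10 O} (hv : IntegrableOn v (Ioo 0 T)) :
    IsPrim T (primitive u₀ v) v := IsPrim.of_integrableOn hv u₀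

theorem primitive_zero (u₀ : H2H10 O) (v : ℝ → H2H10 O) : primitive u₀ v 0 = u₀ := by
  simp [primitive]

theorem memory_zero (k : ℝ → ℝ) (u : ℝ → H2H10 O) : memory k u 0 = 0 := by simp [memory]

theorem divFree_jac_iff (a : H2H10 O) : DivFree (jac a) ↔ (divL O ∘L jacL O) a = 0 :=
  (divL_eq_zero_iff _).symm

end

/-! ### Convective terms and the residual of the momentum equation. -/

section

variable {O : Set E3} [hOb : Fact (Bornology.IsBounded O)]

/-- A convective term `N`, its derivative `N'` and its contribution `K` to the kernel equation,
realised as operators into `L^{4/3}`. -/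
structure ConvectiveTerm (φ : H2H10 O) (N : H2H10 O → E3 → E3)
    (N' : H2H10 O → H2H10 O → E3 → E3) (K : H2H10 O → H2H10 O → ℝ) where
  op : H2H10 O → L43 O
  opDeriv : H2H10 O → H2H10 O → L43 O
  coeFn_op : ∀ u, op u =ᵐ[volume.restrict O] N u
  coeFn_opDeriv : ∀ u v, opDeriv u v =ᵐ[volume.restrict O] N' u v
  isPrim : ∀ {T : ℝ} {u v : ℝ → H2H10 O}, IsPrim T u v →
    IsPrim T (fun t => op (u t)) (fun t => opDeriv (u t) (v t))
  -- Skew-symmetry moves the derivative onto `φ`; this is where the sign of the convective term in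
  -- the equation for `k` comes from.
  dual_opDeriv : ∀ u v, DivFree (jac u) → DivFree (jac v) →
    dualL O (opDeriv u v) (toH10 φ) = - K u v

theorem pairing_convect (a b c : H2H10 O) :
    pairing O (convect a b) (vel c) = dualL O (convectL O (toH10 a) (jac b)) (toH10 c) :=
  pairing_eq_dualL (coeFn_convectL (toH10 a) (jac b)).symm Filter.EventuallyEq.rfl

/-- The convective term of the Kelvin–Voigt system. -/
def kvConvectiveTerm (φ : H2H10 O) :
    ConvectiveTerm φ kvTerm kvTermDeriv (kvKernelTerm φ) where
  op u := convectL O (toH10 u) (jac u)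
  opDeriv u v := convectL O (toH10 v) (jac u) + convectL O (toH10 u) (jac v)
  coeFn_op u := coeFn_convectL _ _
  coeFn_opDeriv u v := (Lp.coeFn_add _ _).trans ((coeFn_convectL _ _).add (coeFn_convectL _ _))
  isPrim h := (h.clm (toH10L O)).bilin (convectL O) (h.clm (jacL O))
  dual_opDeriv u v hu hv := by
    rw [map_add, _root_.add_apply, kvKernelTerm, pairing_convect, pairing_convect, neg_add]
    exact congrArg₂ _ (dualL_convectL_skew (toH10 v) hv (toH10 u) (toH10 φ))
      (dualL_convectL_skew (toH10 u) hu (toH10 v) (toH10 φ))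

/-- The convective term of the Oseen type system. -/
def oseenConvectiveTerm (φ U : H2H10 O) (hU : DivFree (jac U)) :
    ConvectiveTerm φ (oseenTerm U) (oseenTermDeriv U) (oseenKernelTerm U φ) where
  op u := convectL O (toH10 U) (jac u)
  opDeriv _ v := convectL O (toH10 U) (jac v)
  coeFn_op u := coeFn_convectL _ _
  coeFn_opDeriv u v := coeFn_convectL _ _
  isPrim h := h.clm ((convectL O (toH10 U)).comp (jacL O))
  dual_opDeriv u v hu hv := by
    rw [oseenKernelTerm, pairing_convect]
    exact dualL_convectL_skew (toH10 U) hU (toH10 v) (toH10 φ)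

variable {φ : H2H10 O} {N : H2H10 O → E3 → E3} {N' : H2H10 O → H2H10 O → E3 → E3}
  {K : H2H10 O → H2H10 O → ℝ} (d : ConvectiveTerm φ N N' K) {T μ₀ μ₁ : ℝ}

theorem dualL_inclL_toH10 (f : L2 O E3) (a : H2H10 O) :
    dualL O (inclL O f) (toH10 a) = inner ℝ f (vel a) := dualL_inclL f (toH10 a)

theorem inner_lap_vel (a b : H2H10 O) :
    (inner ℝ (lap a) (vel b) : ℝ) = inner ℝ (vel a) (lap b) := by
  rw [← dualL_inclL_toH10, dualL_lap_comm, dualL_inclL_toH10, real_inner_comm]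

namespace ConvectiveTerm

/-- The momentum equation without pressure, with velocity `u`, acceleration `v` and memory
term `m`. -/
def residual (μ₀ μ₁ : ℝ) (v u : H2H10 O) (m : L2 O E3) : L43 O :=
  inclL O (velL O v - μ₁ • lapL O v - μ₀ • lapL O u - m) + d.op u

/-- The time derivative of the momentum equation without pressure. -/
def residualDeriv (μ₀ μ₁ : ℝ) (u₀ w v u : H2H10 O) (κ : ℝ) (m : L2 O E3) : L43 O :=
  inclL O (velL O w - μ₁ • lapL O w - μ₀ • lapL O v - (κ • lapL O u₀ + m)) + d.opDeriv u v

theorem coeFn_residual_add (v u : H2H10 O) (m : L2 O E3) (p : H1 O ℝ) :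
    (d.residual μ₀ μ₁ v u m + inclL O (gradL O p) : L43 O) =ᵐ[volume.restrict O] fun x =>
      vel v x - μ₁ • lap v x - μ₀ • lap u x + N u x - m x + gradVec p x := by
  rw [residual]
  filter_upwards [Lp.coeFn_add (inclL O (velL O v - μ₁ • lapL O v - μ₀ • lapL O u - m) + d.op u)
    (inclL O (gradL O p)),
    Lp.coeFn_add (inclL O (velL O v - μ₁ • lapL O v - μ₀ • lapL O u - m)) (d.op u),
    coeFn_inclL (velL O v - μ₁ • lapL O v - μ₀ • lapL O u - m), coeFn_inclL (gradL O p),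
    coeFn_gradL p, d.coeFn_op u, Lp.coeFn_sub (velL O v - μ₁ • lapL O v - μ₀ • lapL O u) m,
    Lp.coeFn_sub (velL O v - μ₁ • lapL O v) (μ₀ • lapL O u),
    Lp.coeFn_sub (velL O v) (μ₁ • lapL O v), Lp.coeFn_smul μ₁ (lapL O v),
    Lp.coeFn_smul μ₀ (lapL O u)] with x h1 h2 h3 h4 h5 h6 h7 h8 h9 h10 h11
  simp only [h1, h2, h3, h4, h5, h6, h7, h8, h9, h10, h11, Pi.add_apply, Pi.sub_apply,
    Pi.smul_apply]
  simp only [lapL_apply, velL_apply]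
  abel

theorem coeFn_residualDeriv (u₀ w v u : H2H10 O) (κ : ℝ) (m : L2 O E3) :
    d.residualDeriv μ₀ μ₁ u₀ w v u κ m =ᵐ[volume.restrict O] fun x =>
      vel w x - μ₁ • lap w x - μ₀ • lap v x - κ • lap u₀ x - m x + N' u v x := by
  rw [residualDeriv]
  filter_upwards [
    Lp.coeFn_add (inclL O (velL O w - μ₁ • lapL O w - μ₀ • lapL O v - (κ • lapL O u₀ + m)))
      (d.opDeriv u v),
    coeFn_inclL (velL O w - μ₁ • lapL O w - μ₀ • lapL O v - (κ • lapL O u₀ + m)),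
    d.coeFn_opDeriv u v,
    Lp.coeFn_sub (velL O w - μ₁ • lapL O w - μ₀ • lapL O v) (κ • lapL O u₀ + m),
    Lp.coeFn_add (κ • lapL O u₀) m,
    Lp.coeFn_sub (velL O w - μ₁ • lapL O w) (μ₀ • lapL O v),
    Lp.coeFn_sub (velL O w) (μ₁ • lapL O w), Lp.coeFn_smul μ₁ (lapL O w),
    Lp.coeFn_smul μ₀ (lapL O v), Lp.coeFn_smul κ (lapL O u₀)]
    with x h1 h2 h3 h4 h5 h6 h7 h8 h9 h10
  simp only [h1, h2, h3, h4, h5, h6, h7, h8, h9, h10, Pi.add_apply, Pi.sub_apply,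
    Pi.smul_apply]
  simp only [lapL_apply, velL_apply]
  abel

/-- Termwise differentiation; the memory term contributes `k Δu(0)`. In use, `v'` is the continuous
representative of `v`, so that the residual has a value at every time. -/
theorem isPrim_residual {u v v' w : ℝ → H2H10 O} {k : ℝ → ℝ} (hu : IsPrim T u v)
    (hv : IsPrim T v' w) (hk : IntegrableOn k (Ioo 0 T)) :
    IsPrim T (fun t => d.residual μ₀ μ₁ (v' t) (u t) (memory k u t))
      (fun t => d.residualDeriv μ₀ μ₁ (u 0) (w t) (v t) (u t) (k t) (memory k v t)) := by
  have hm : IsPrim T (memory k u) (fun t => k t • lapL O (u 0) + memory k v t) := by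
    have h := (hu.clm (lapL O)).volterra hk
    simp only [lapL_apply] at h ⊢
    exact h
  exact (((((hv.clm (velL O)).sub ((hv.clm (lapL O)).const_smul μ₁)).sub
    ((hu.clm (lapL O)).const_smul μ₀)).sub hm).clm (inclL O)).add (d.isPrim hu)

/-- The momentum balance at the initial time, tested with an element of `H¹₀`. -/
theorem dualL_residual_initial {u₀ : H2H10 O} {p₀ : H1 O ℝ} {v₀ : H10 O E3}
    (hres : IsResolvent μ₁ v₀ (fun x => μ₀ • lap u₀ x - N u₀ x - gradVec p₀ x))
    (V : H2H10 O) (z : H10 O E3) :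
    dualL O (d.residual μ₀ μ₁ V u₀ 0 + inclL O (gradL O p₀)) z =
      dualL O (inclL O (toH10 V - v₀).1.1) z + μ₁ * frobPairL O (toH10 V - v₀).1.2 z.1.2 := by
  have hf : (fun x => μ₀ • lap u₀ x - N u₀ x - gradVec p₀ x) =ᵐ[volume.restrict O]
      (inclL O (μ₀ • lapL O u₀ - gradL O p₀) - d.op u₀ : L43 O) := by
    filter_upwards [Lp.coeFn_sub (inclL O (μ₀ • lapL O u₀ - gradL O p₀)) (d.op u₀),
      coeFn_inclL (μ₀ • lapL O u₀ - gradL O p₀), Lp.coeFn_sub (μ₀ • lapL O u₀) (gradL O p₀),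
      Lp.coeFn_smul μ₀ (lapL O u₀), coeFn_gradL p₀, d.coeFn_op u₀] with x h1 h2 h3 h4 h5 h6
    simp only [h1, h2, h3, h4, h5, h6, Pi.sub_apply, Pi.smul_apply]
    simp only [lapL_apply]
    abel
  have h := hres.dualL hf z
  -- Green's formula puts `-μ₁ΔV` into the weak form used for `v₀`, which is only in `H¹₀`, so the
  -- two can be subtracted.
  have hl := dualL_lap V z
  have e1 : (toH10 V - v₀).1.1 = velL O V - v₀.1.1 := rfl
  have e2 : (toH10 V - v₀).1.2 = jac V - v₀.1.2 := rfl
  rw [e1, e2, residual]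
  simp only [map_add, map_sub, map_smul, _root_.add_apply, _root_.sub_apply, _root_.smul_apply,
    lapL_apply, smul_eq_mul, sub_zero] at h ⊢
  rw [hl]
  linarith

/-- Symmetry of the Laplacian moves `I - μ₁Δ` from `φ` to `a`, the form in which it occurs in the
residual. -/
theorem _root_.KelvinVoigt.weightL_apply (μ₁ : ℝ) (φ a : H2H10 O) :
    weightL μ₁ φ a = inner ℝ (vel a) (vel φ) - μ₁ * inner ℝ (lap a) (vel φ) := by
  change (inner ℝ (vel φ - μ₁ • lap φ) (vel a) : ℝ) = _
  rw [inner_sub_left, real_inner_smul_left, inner_lap_vel a φ, real_inner_comm (vel a) (vel φ),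
    real_inner_comm (vel a) (lap φ)]

theorem _root_.KelvinVoigt.inner_memory_ae {v : ℝ → H2H10 O} {k : ℝ → ℝ}
    (hk : IntegrableOn k (Ioo 0 T)) (hv : IntegrableOn v (Ioo 0 T)) (φ : H2H10 O) :
    ∀ᵐ t ∂(volume.restrict (Ioo 0 T)), (inner ℝ (vel φ) (memory k v t) : ℝ) =
      ∫ s in (0 : ℝ)..t, k (t - s) * pairing O (vel (v s)) (lap φ) := by
  have hi : IntegrableOn (fun s => lap (v s)) (Ioo 0 T) := by
    have := ((IsPrim.of_integrableOn hv 0).clm (lapL O)).integrableOn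
    simpa only [lapL_apply] using this
  have hm := clm_volterra_ae (innerSL ℝ (vel φ) : L2 O E3 →L[ℝ] ℝ) hk hi
  filter_upwards [hm] with t h1
  refine Eq.trans h1 ?_
  rw [volterra]
  congr 1
  funext s
  rw [smul_eq_mul, pairing_coe, ← inner_lap_vel, real_inner_comm]
  rfl

/-- The differentiated momentum equation tested with the weight `φ`. -/
theorem dualL_residualDeriv (u₀ w v u : H2H10 O) (κ : ℝ) (m : L2 O E3)
    (hu : DivFree (jac u)) (hv : DivFree (jac v)) :
    dualL O (d.residualDeriv μ₀ μ₁ u₀ w v u κ m) (toH10 φ) =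
      weightL μ₁ φ w - μ₀ * pairing O (vel v) (lap φ) - κ * pairing O (vel φ) (lap u₀)
        - inner ℝ (vel φ) m - K u v := by
  rw [residualDeriv, map_add, _root_.add_apply, dualL_inclL_toH10, d.dual_opDeriv _ _ hu hv,
    weightL_apply, pairing_coe, pairing_coe, lapL_apply, lapL_apply, lapL_apply, velL_apply,
    inner_sub_left, inner_sub_left, inner_sub_left, inner_add_left,
    real_inner_smul_left (lap w) (vel φ) μ₁, real_inner_smul_left (lap v) (vel φ) μ₀,
    real_inner_smul_left (lap u₀) (vel φ) κ, inner_lap_vel v φ,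
    real_inner_comm (vel φ) (lap u₀), real_inner_comm (vel φ) m]
  ring

end ConvectiveTerm

end

/-! ### Divergence free paths. -/

section

variable {O : Set E3}

/-- The divergence is bounded and linear, so `div u` is a primitive of `div v`. Vanishing almost
everywhere, it vanishes at every time by continuity, `t = 0` included, and so does its derivative
almost everywhere. -/
theorem divFree_of_isPrim {T : ℝ} (hT : 0 < T) {u v : ℝ → H2H10 O} (h : IsPrim T u v)
    (hu : ∀ᵐ t ∂(volume.restrict (Ioo 0 T)), DivFree (jac (u t))) :
    (∀ t ∈ Icc 0 T, DivFree (jac (u t))) ∧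
      ∀ᵐ t ∂(volume.restrict (Ioo 0 T)), DivFree (jac (v t)) := by
  have hp := h.clm (divL O ∘L jacL O)
  have h0 : (fun t => (divL O ∘L jacL O) (u t)) =ᵐ[volume.restrict (Ioo 0 T)] 0 := by
    filter_upwards [hu] with t ht
    exact (divFree_jac_iff _).1 ht
  refine ⟨fun t ht => (divFree_jac_iff _).2 (hp.eq_zero_of_ae_eq_zero hT h0 ht), ?_⟩
  filter_upwards [hp.ae_eq_zero hT h0] with t ht
  exact (divFree_jac_iff _).2 ht

theorem divFree_primitive {T : ℝ} {u₀ : H2H10 O} {v : ℝ → H2H10 O} (hu₀ : DivFree (jac u₀))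
    (hv : IntegrableOn v (Ioo 0 T))
    (hdv : ∀ᵐ t ∂(volume.restrict (Ioo 0 T)), DivFree (jac (v t))) :
    ∀ t ∈ Icc 0 T, DivFree (jac (primitive u₀ v t)) := by
  intro t ht
  have h0 : (fun t => (divL O ∘L jacL O) (v t)) =ᵐ[volume.restrict (Ioo 0 T)] fun _ => 0 := by
    filter_upwards [hdv] with t ht
    exact (divFree_jac_iff _).1 ht
  have hp := ((isPrim_primitive u₀ hv).clm (divL O ∘L jacL O)).congr (fun _ _ => rfl) h0.symm
  rw [divFree_jac_iff, hp.eq_add t ht, primitive_zero, (divFree_jac_iff _).1 hu₀]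
  simp

theorem continuousOn_toH10 {V : ℝ → H2H10 O} {s : Set ℝ} (hV : ContinuousOn V s) :
    ContinuousOn (fun t => toH10 (V t)) s :=
  (toH10L O).continuous.comp_continuousOn hV

end

/-! ### The two implications for a general convective term. -/

namespace ConvectiveTerm

variable {O : Set E3} [hOb : Fact (Bornology.IsBounded O)]
  {φ : H2H10 O} {N : H2H10 O → E3 → E3} {N' : H2H10 O → H2H10 O → E3 → E3}
  {K : H2H10 O → H2H10 O → ℝ} {T μ₀ μ₁ : ℝ}
  {u₀ : H2H10 O} {p₀ : H1 O ℝ} {v₀ : H10 O E3} {r r' r'' : ℝ → ℝ} {p : ℝ → H1 O ℝ}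

theorem pairing_gradVec_eq (q : H1 O ℝ) {ψ : E3 → E3} {z : H10 O E3}
    (hz : z.1.1 =ᵐ[volume.restrict O] ψ) :
    pairing O (gradVec q) ψ = dualL O (inclL O (gradL O q)) z :=
  pairing_eq_dualL ((coeFn_gradL q).symm.trans (coeFn_inclL _).symm) hz.symm

/-- If the momentum equation holds, the residual is orthogonal to divergence free fields. -/
theorem dualL_residual_eq_zero (hT : 0 < T) {S F : ℝ → L43 O} (hS : IsPrim T S F)
    (h : ∀ᵐ t ∂(volume.restrict (Ioo 0 T)), S t + inclL O (gradL O (p t)) = 0)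
    (z : H10 O E3) (hz : DivFree z.1.2) : EqOn (fun t => dualL O (S t) z) 0 (Icc 0 T) := by
  -- Continuity in time upgrades the almost everywhere identity to all of `[0,T]`, which gives
  -- access to `t = 0`.
  refine (hS.clm ((dualL O).flip z)).eq_zero_of_ae_eq_zero hT ?_
  filter_upwards [h] with t ht
  change dualL O (S t) z = 0
  rw [eq_neg_of_add_eq_zero_left ht, map_neg, _root_.neg_apply, dualL_gradL _ _ hz, neg_zero]

theorem residual_add_eq_zero_iff (d : ConvectiveTerm φ N N' K) (v u : H2H10 O) (m : L2 O E3)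
    (q : H1 O ℝ) : d.residual μ₀ μ₁ v u m + inclL O (gradL O q) = 0 ↔
      ∀ᵐ x ∂(volume.restrict O),
        vel v x - μ₁ • lap v x - μ₀ • lap u x + N u x - m x + gradVec q x = 0 := by
  rw [Lp.eq_zero_iff_ae_eq_zero]
  have h := d.coeFn_residual_add (μ₀ := μ₀) (μ₁ := μ₁) v u m q
  constructor
  · intro h'
    filter_upwards [h, h'] with x h1 h2
    exact h1.symm.trans h2
  · intro h'
    filter_upwards [h, h'] with x h1 h2
    exact h1.trans h2

/-- The residual along `u = u₀ + ∫ v`, with `V` the continuous representative of `v`. -/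
def residualPath (d : ConvectiveTerm φ N N' K) (μ₀ μ₁ : ℝ) (u₀ : H2H10 O) (V v : ℝ → H2H10 O)
    (k : ℝ → ℝ) (t : ℝ) : L43 O :=
  d.residual μ₀ μ₁ (V t) (primitive u₀ v t) (memory k (primitive u₀ v) t)

/-- The derivative of the residual along `u = u₀ + ∫ v`. -/
def residualDerivPath (d : ConvectiveTerm φ N N' K) (μ₀ μ₁ : ℝ) (u₀ : H2H10 O)
    (w v : ℝ → H2H10 O) (k : ℝ → ℝ) (t : ℝ) : L43 O :=
  d.residualDeriv μ₀ μ₁ u₀ (w t) (v t) (primitive u₀ v t) (k t) (memory k v t)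

theorem isPrim_residualPath (d : ConvectiveTerm φ N N' K) {V v w : ℝ → H2H10 O} {k : ℝ → ℝ}
    (hv : IntegrableOn v (Ioo 0 T)) (hV : IsPrim T V w) (hk : IntegrableOn k (Ioo 0 T)) :
    IsPrim T (d.residualPath μ₀ μ₁ u₀ V v k) (d.residualDerivPath μ₀ μ₁ u₀ w v k) := by
  have hS := d.isPrim_residual (μ₀ := μ₀) (μ₁ := μ₁) (isPrim_primitive u₀ hv) hV hk
  rw [primitive_zero] at hS
  exact hS

theorem residualPath_zero (d : ConvectiveTerm φ N N' K) (V v : ℝ → H2H10 O) (k : ℝ → ℝ) :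
    d.residualPath μ₀ μ₁ u₀ V v k 0 = d.residual μ₀ μ₁ (V 0) u₀ 0 := by
  rw [residualPath, primitive_zero, memory_zero]

theorem pairing_residualDeriv (d : ConvectiveTerm φ N N' K) (w v : ℝ → H2H10 O)
    (k : ℝ → ℝ) (t : ℝ) {ψ : E3 → E3} {z : H10 O E3} (hz : z.1.1 =ᵐ[volume.restrict O] ψ) :
    pairing O (fun x => vel (w t) x - μ₁ • lap (w t) x - μ₀ • lap (v t) x - k t • lap u₀ x
      - memory k v t x + N' (primitive u₀ v t) (v t) x) ψ =
      dualL O (d.residualDerivPath μ₀ μ₁ u₀ w v k t) z :=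
  pairing_eq_dualL (d.coeFn_residualDeriv u₀ (w t) (v t) (primitive u₀ v t) (k t)
    (memory k v t)).symm hz.symm

/-- The initial momentum balance when the initial acceleration is `v₀`. -/
theorem dualL_residual_initial_of_eq (d : ConvectiveTerm φ N N' K)
    (hres : IsResolvent μ₁ v₀ (fun x => μ₀ • lap u₀ x - N u₀ x - gradVec p₀ x))
    {V : H2H10 O} (hV : toH10 V = v₀) (z : H10 O E3) :
    -dualL O (d.residual μ₀ μ₁ V u₀ 0) z = dualL O (inclL O (gradL O p₀)) z := by
  have h := d.dualL_residual_initial hres V z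
  rw [hV, sub_self, map_add, _root_.add_apply] at h
  have e : dualL O (inclL O (0 : H10 O E3).1.1) z + μ₁ * frobPairL O (0 : H10 O E3).1.2 z.1.2
      = 0 := by
    simp
  rw [e] at h
  linarith

/-- A divergence free solution of the momentum balance has the initial acceleration `v₀`. -/
theorem toH10_eq_of_residual_initial (d : ConvectiveTerm φ N N' K) (hμ₁ : 0 < μ₁)
    (hv₀ : DivFree v₀.1.2)
    (hres : IsResolvent μ₁ v₀ (fun x => μ₀ • lap u₀ x - N u₀ x - gradVec p₀ x))
    {V : H2H10 O} (hV : DivFree (jac V))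
    (h : ∀ z : H10 O E3, DivFree z.1.2 → dualL O (d.residual μ₀ μ₁ V u₀ 0) z = 0) :
    toH10 V = v₀ := by
  have hdz : DivFree (toH10 V - v₀).1.2 := by
    have e : (toH10 V - v₀).1.2 = jac V - v₀.1.2 := rfl
    rw [← divL_eq_zero_iff, e, map_sub, (divL_eq_zero_iff _).2 hV,
      (divL_eq_zero_iff _).2 hv₀, sub_zero]
  -- The difference is divergence free, hence an admissible test field for itself: `∇p₀` drops out
  -- and its energy is zero.
  refine sub_eq_zero.1 (H10.eq_zero_of_energy hμ₁ ?_)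
  rw [← d.dualL_residual_initial hres V, map_add, _root_.add_apply, dualL_gradL _ _ hdz,
    add_zero, h _ hdz]

/-- The momentum equation tested with the weight, differentiated in time. -/
theorem weight_balance (d : ConvectiveTerm φ N N' K) (hT : 0 < T) {V v w : ℝ → H2H10 O}
    {k : ℝ → ℝ} (hv : IntegrableOn v (Ioo 0 T)) (hV : IsPrim T V w)
    (hk : IntegrableOn k (Ioo 0 T))
    (hdu : ∀ t ∈ Icc 0 T, DivFree (jac (primitive u₀ v t)))
    (hdv : ∀ᵐ t ∂(volume.restrict (Ioo 0 T)), DivFree (jac (v t)))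
    (h : EqOn (fun t => dualL O (d.residualPath μ₀ μ₁ u₀ V v k t) (toH10 φ)) 0 (Icc 0 T)) :
    ∀ᵐ t ∂(volume.restrict (Ioo 0 T)),
      k t * pairing O (vel φ) (lap u₀) = weightL μ₁ φ (w t) - μ₀ * pairing O (vel (v t)) (lap φ)
        - (∫ s in (0 : ℝ)..t, k (t - s) * pairing O (vel (v s)) (lap φ))
        - K (primitive u₀ v t) (v t) := by
  have hF := ((d.isPrim_residualPath (μ₀ := μ₀) (μ₁ := μ₁) (u₀ := u₀) hv hV hk).clm
    ((dualL O).flip (toH10 φ))).ae_eq_zero hT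
      ((ae_restrict_iff' measurableSet_Ioo).2 (Filter.Eventually.of_forall fun t ht =>
        h (Ioo_subset_Icc_self ht)))
  filter_upwards [hF, hdv, inner_memory_ae hk hv φ, ae_restrict_mem measurableSet_Ioo]
    with t h1 h2 h3 h4
  have h5 := d.dualL_residualDeriv (μ₀ := μ₀) (μ₁ := μ₁) u₀ (w t) (v t) (primitive u₀ v t) (k t)
    (memory k v t) (hdu t (Ioo_subset_Icc_self h4)) h2
  rw [h3] at h5
  have h6 := h5.symm.trans h1
  simp only [Pi.zero_apply] at h6
  linarith

/-- The pressure paired with a test field, expressed through the residual. -/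
theorem pairing_gradVec_ae_eq {S : ℝ → L43 O}
    (h : ∀ᵐ t ∂(volume.restrict (Ioo 0 T)), S t + inclL O (gradL O (p t)) = 0)
    {ψ : E3 → E3} {z : H10 O E3} (hz : z.1.1 =ᵐ[volume.restrict O] ψ) :
    (fun t => pairing O (gradVec (p t)) ψ) =ᵐ[volume.restrict (Ioo 0 T)] fun t =>
      (-(dualL O).flip z) (S t) := by
  filter_upwards [h] with t ht
  rw [pairing_gradVec_eq _ hz, eq_neg_of_add_eq_zero_right ht, map_neg]
  rfl

/-- From the inverse problem to the differentiated problem. -/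
theorem solvesDifferentiated (d : ConvectiveTerm φ N N' K) (hT : 0 < T) (hμ₁ : 0 < μ₁)
    (hφ : DivFree (jac φ)) (hα : pairing O (vel φ) (lap u₀) ≠ 0) (hv₀ : DivFree v₀.1.2)
    (hrr' : HasWeakTimeDeriv T r r') (hrr'' : HasWeakTimeDeriv T r' r'')
    (hres : IsResolvent μ₁ v₀ (fun x => μ₀ • lap u₀ x - N u₀ x - gradVec p₀ x))
    {u v : ℝ → H2H10 O} {k : ℝ → ℝ} (hu : MemHTime T 2 u) (hk : MemL2Time T k)
    (hs : SolvesInverse N T μ₀ μ₁ u₀ φ r u k p) (huv : HasWeakTimeDeriv T u v) :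
    MemHTime T 1 v ∧ SolvesDifferentiated N' K T μ₀ μ₁ u₀ φ v₀ r'' v k p ∧
      HasInitialPressure T p p₀ ∧ u =ᵐ[volume.restrict (Ioo 0 T)] primitive u₀ v := by
  obtain ⟨hu0, g, hug, hg, w, hgw, hw⟩ := hu
  have hvg := huv.unique hug
  have hv : MemL2Time T v := MemLp.ae_eq hvg.symm hg
  have hvw : HasWeakTimeDeriv T v w := hgw.congr hvg Filter.EventuallyEq.rfl
  have hw' : MemL2Time T w := hw
  have hup : u =ᵐ[volume.restrict (Ioo 0 T)] primitive u₀ v :=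
    huv.ae_eq_primitive hT hv.integrableOn hs.initial
  obtain ⟨V, hV, hvV⟩ := hvw.exists_isPrim hT hw'.integrableOn
  have hU := isPrim_primitive u₀ hv.integrableOn
  have hS := d.isPrim_residualPath (μ₀ := μ₀) (μ₁ := μ₁) (u₀ := u₀) hv.integrableOn hV
    hk.integrableOn
  have hmom : ∀ᵐ t ∂(volume.restrict (Ioo 0 T)),
      d.residualPath μ₀ μ₁ u₀ V v k t + inclL O (gradL O (p t)) = 0 := by
    -- The time derivative in the momentum equation is existentially quantified; uniqueness of weak
    -- derivatives identifies it with `v`.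
    obtain ⟨v', huv', hm⟩ := hs.momentum
    filter_upwards [hm, huv'.unique huv, hvV, hup, ae_restrict_mem measurableSet_Ioo]
      with t h1 h2 h3 h4 h5
    have e : memory k u t = memory k (primitive u₀ v) t :=
      volterra_congr (Ioo_subset_Icc_self h5) k (by
        filter_upwards [hup] with s hs
        rw [hs])
    rw [h2, h3, h4, e] at h1
    exact (d.residual_add_eq_zero_iff _ _ _ _).2 h1
  have horth := dualL_residual_eq_zero hT hS hmom
  obtain ⟨hdU, hdv⟩ := divFree_of_isPrim hT hU (by
    filter_upwards [hs.incompressible, hup] with t h1 h2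
    rwa [← h2])
  have hdV := (divFree_of_isPrim hT hV (by
    filter_upwards [hdv, hvV] with t h1 h2
    rwa [← h2])).1
  have h0 : (0 : ℝ) ∈ Icc 0 T := ⟨le_rfl, hT.le⟩
  have hV0 : toH10 (V 0) = v₀ := by
    refine d.toH10_eq_of_residual_initial hμ₁ hv₀ hres (hdV 0 h0) fun z hz => ?_
    rw [← d.residualPath_zero V v k]
    exact horth z hz h0
  refine ⟨⟨hv, w, hvw, hw⟩, ⟨hs.pressure_mem, ⟨w, hvw, fun ψ hψ => ?_⟩, hdv, ?_, ?_⟩,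
    fun ψ hψ => ?_, hup⟩
  -- No time derivative of `p` is assumed: `⟨∇p, ψ⟩ = -⟨S, ψ⟩` almost everywhere, and the right side
  -- is absolutely continuous.
  · obtain ⟨z, hz, -⟩ := hψ.exists_H10
    refine ((hS.clm (-(dualL O).flip z)).hasWeakTimeDeriv hT).congr
      (pairing_gradVec_ae_eq hmom hz) (Filter.Eventually.of_forall fun t => ?_)
    exact congrArg Neg.neg (d.pairing_residualDeriv w v k t hz)
  · refine ⟨fun t => toH10 (V t), continuousOn_toH10 hV.continuousOn, ?_, hV0⟩
    filter_upwards [hvV] with t ht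
    rw [ht]
  -- Differentiate the overdetermination condition twice; by uniqueness of weak derivatives `r'' =
  -- ℓ(w)`, which is then inserted into the balance for `φ`.
  · have hr1 : r =ᵐ[volume.restrict (Ioo 0 T)] fun t => weightL μ₁ φ (primitive u₀ v t) := by
      filter_upwards [hs.overdetermination, hup] with t h1 h2
      rw [← h1, ← h2, pairing_weight]
    have hr2 : r' =ᵐ[volume.restrict (Ioo 0 T)] fun t => weightL μ₁ φ (v t) :=
      hrr'.unique (((hU.clm (weightL μ₁ φ)).hasWeakTimeDeriv hT).congr hr1
        Filter.EventuallyEq.rfl)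
    have hr2' : r' =ᵐ[volume.restrict (Ioo 0 T)] fun t => weightL μ₁ φ (V t) := by
      filter_upwards [hr2, hvV] with t h1 h2
      rw [h1, h2]
    have hr3 : r'' =ᵐ[volume.restrict (Ioo 0 T)] fun t => weightL μ₁ φ (w t) :=
      hrr''.unique (((hV.clm (weightL μ₁ φ)).hasWeakTimeDeriv hT).congr hr2'
        Filter.EventuallyEq.rfl)
    filter_upwards [hr3, d.weight_balance hT hv.integrableOn hV hk.integrableOn hdU hdv
      (horth (toH10 φ) hφ)] with t h1 h2
    rw [eq_inv_mul_iff_mul_eq₀ hα, mul_comm, h2, h1]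
  · obtain ⟨z, hz, -⟩ := hψ.exists_H10
    refine ⟨_, (hS.clm (-(dualL O).flip z)).continuousOn, pairing_gradVec_ae_eq hmom hz, ?_⟩
    rw [residualPath_zero, pairing_gradVec_eq _ hz]
    exact d.dualL_residual_initial_of_eq hres hV0 z

theorem neg_flip_dualL_apply (F : L43 O) (z : H10 O E3) :
    (-(dualL O).flip z) F = -dualL O F z := rfl

theorem integrableOn_inclL_gradL (hp : IntegrableOn p (Ioo 0 T)) :
    IntegrableOn (fun t => inclL O (gradL O (p t))) (Ioo 0 T) :=
  (inclL O ∘L gradL O).integrable_comp hp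

/-- A path in `L43 O` vanishes almost everywhere if its pairings with test fields do. -/
theorem ae_eq_zero_of_forall_dualL (hO : IsOpen O) {G : ℝ → L43 O}
    (hG : LocallyIntegrableOn G (Ioo 0 T))
    (h : ∀ (ψ : E3 → E3) (z : H10 O E3), IsTestFunction O ψ →
      z.1.1 =ᵐ[volume.restrict O] ψ → ∀ᵐ t ∂(volume.restrict (Ioo 0 T)), dualL O (G t) z = 0) :
    ∀ᵐ t ∂(volume.restrict (Ioo 0 T)), G t = 0 := by
  -- The exceptional null set depends on `ψ`. Integrating against `θ` in time first, and only then
  -- separating points in space, avoids a countable family of test fields.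
  refine ae_eq_zero_of_forall_test hG fun θ hθ => ?_
  refine L43.eq_zero_of_forall_test hO _ fun ψ hψ => ?_
  obtain ⟨z, hz, -⟩ := hψ.exists_H10
  rw [pairing_eq_dualL Filter.EventuallyEq.rfl hz.symm]
  have e := ((dualL O).flip z).integral_comp_comm (hθ.integrableOn_smul hG)
  refine e.symm.trans (integral_eq_zero_of_ae ?_)
  filter_upwards [h ψ z hψ hz] with t ht
  have e2 : (dualL O).flip z (G t) = 0 := ht
  simp [map_smul, e2]

/-- The momentum equation of the inverse problem, tested with a test field. -/
theorem dualL_residualPath_ae_eq (d : ConvectiveTerm φ N N' K) (hT : 0 < T)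
    (hres : IsResolvent μ₁ v₀ (fun x => μ₀ • lap u₀ x - N u₀ x - gradVec p₀ x))
    {V v w : ℝ → H2H10 O} {k : ℝ → ℝ} (hV : IsPrim T V w) (hV0 : toH10 (V 0) = v₀)
    (hvw : HasWeakTimeDeriv T v w) (hv : MemL2Time T v) (hk : MemL2Time T k)
    (hs : SolvesDifferentiated N' K T μ₀ μ₁ u₀ φ v₀ r'' v k p)
    (hp : HasInitialPressure T p p₀) {ψ : E3 → E3} {z : H10 O E3} (hψ : IsTestFunction O ψ)
    (hz : z.1.1 =ᵐ[volume.restrict O] ψ) :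
    ∀ᵐ t ∂(volume.restrict (Ioo 0 T)), dualL O (inclL O (gradL O (p t))) z =
      -dualL O (d.residualPath μ₀ μ₁ u₀ V v k t) z := by
  obtain ⟨w', hvw', hm⟩ := hs.momentum
  have hww := hvw'.unique hvw
  have h2 := (d.isPrim_residualPath (μ₀ := μ₀) (μ₁ := μ₁) (u₀ := u₀) hv.integrableOn hV
    hk.integrableOn).clm (-(dualL O).flip z)
  simp only [neg_flip_dualL_apply] at h2
  -- The constant of integration: `V(0) = v₀` and the equation for `v₀` give `-⟨S(0), ψ⟩ = ⟨∇p₀,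
  -- ψ⟩`, the prescribed initial value.
  have h3 : HasInitialValue T (fun t => pairing O (gradVec (p t)) ψ)
      (-dualL O (d.residualPath μ₀ μ₁ u₀ V v k 0) z) := by
    rw [residualPath_zero, d.dualL_residual_initial_of_eq hres hV0 z, ← pairing_gradVec_eq _ hz]
    exact hp ψ hψ
  have h4 := (hm ψ hψ).ae_eq_of_isPrim hT h2 (by
    filter_upwards [hww] with t ht
    rw [d.pairing_residualDeriv w' v k t hz, residualDerivPath, residualDerivPath, ht]) h3
  filter_upwards [h4] with t ht
  rwa [pairing_gradVec_eq _ hz] at ht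

/-- The momentum equation of the inverse problem, recovered from the differentiated one. -/
theorem residualPath_add_eq_zero (d : ConvectiveTerm φ N N' K) (hO : IsOpen O) (hT : 0 < T)
    (hres : IsResolvent μ₁ v₀ (fun x => μ₀ • lap u₀ x - N u₀ x - gradVec p₀ x))
    {V v w : ℝ → H2H10 O} {k : ℝ → ℝ} (hV : IsPrim T V w) (hV0 : toH10 (V 0) = v₀)
    (hvw : HasWeakTimeDeriv T v w) (hv : MemL2Time T v) (hk : MemL2Time T k)
    (hs : SolvesDifferentiated N' K T μ₀ μ₁ u₀ φ v₀ r'' v k p)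
    (hp : HasInitialPressure T p p₀) :
    ∀ᵐ t ∂(volume.restrict (Ioo 0 T)),
      d.residualPath μ₀ μ₁ u₀ V v k t + inclL O (gradL O (p t)) = 0 := by
  have hS := d.isPrim_residualPath (μ₀ := μ₀) (μ₁ := μ₁) (u₀ := u₀) hv.integrableOn hV
    hk.integrableOn
  refine ae_eq_zero_of_forall_dualL hO ((hS.hasWeakTimeDeriv hT).locallyIntegrable.add
    (integrableOn_inclL_gradL hs.pressure_mem.integrableOn).locallyIntegrableOn)
    fun ψ z hψ hz => ?_
  filter_upwards [d.dualL_residualPath_ae_eq hT hres hV hV0 hvw hv hk hs hp hψ hz] with t ht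
  rw [map_add, _root_.add_apply, ht, add_neg_cancel]

/-- The initial momentum balance tested with the weight. -/
theorem weightL_initial (d : ConvectiveTerm φ N N' K) {V : H2H10 O}
    (h : dualL O (d.residual μ₀ μ₁ V u₀ 0) (toH10 φ) = 0) :
    weightL μ₁ φ V = pairing O (fun x => μ₀ • lap u₀ x - N u₀ x) (vel φ) := by
  have e : (fun x => μ₀ • lap u₀ x - N u₀ x) =ᵐ[volume.restrict O]
      (inclL O (μ₀ • lap u₀) - d.op u₀ : L43 O) := by
    filter_upwards [Lp.coeFn_sub (inclL O (μ₀ • lap u₀)) (d.op u₀), coeFn_inclL (μ₀ • lap u₀),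
      Lp.coeFn_smul μ₀ (lap u₀), d.coeFn_op u₀] with x h1 h2 h3 h4
    rw [h1, Pi.sub_apply, h2, h3, h4, Pi.smul_apply]
  have e2 : pairing O (fun x => μ₀ • lap u₀ x - N u₀ x) (vel φ) =
      dualL O (inclL O (μ₀ • lap u₀) - d.op u₀) (toH10 φ) :=
    pairing_eq_dualL e Filter.EventuallyEq.rfl
  rw [e2, weightL_apply, ← dualL_inclL_toH10, ← dualL_inclL_toH10]
  rw [residual] at h
  simp only [map_add, map_sub, map_smul, _root_.add_apply, _root_.sub_apply, _root_.smul_apply,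
    lapL_apply, velL_apply, smul_eq_mul, sub_zero] at h ⊢
  linarith

/-- From the differentiated problem to the inverse problem. -/
theorem solvesInverse (d : ConvectiveTerm φ N N' K) (hO : IsOpen O) (hT : 0 < T)
    (hu₀ : DivFree (jac u₀)) (hφ : DivFree (jac φ)) (hα : pairing O (vel φ) (lap u₀) ≠ 0)
    (hrr' : HasWeakTimeDeriv T r r') (hrr'' : HasWeakTimeDeriv T r' r'')
    (hr0 : HasInitialValue T r (pairing O (fun x => vel φ x - μ₁ • lap φ x) (vel u₀)))
    (hres : IsResolvent μ₁ v₀ (fun x => μ₀ • lap u₀ x - N u₀ x - gradVec p₀ x))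
    (hr'0 : HasInitialValue T r' (pairing O (fun x => μ₀ • lap u₀ x - N u₀ x) (vel φ)))
    {v : ℝ → H2H10 O} {k : ℝ → ℝ} (hv1 : MemHTime T 1 v) (hk : MemL2Time T k)
    (hs : SolvesDifferentiated N' K T μ₀ μ₁ u₀ φ v₀ r'' v k p)
    (hp : HasInitialPressure T p p₀) :
    MemHTime T 2 (primitive u₀ v) ∧ SolvesInverse N T μ₀ μ₁ u₀ φ r (primitive u₀ v) k p ∧
      HasWeakTimeDeriv T (primitive u₀ v) v := by
  obtain ⟨hv, w, hvw, hw⟩ := id hv1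
  have hw' : MemL2Time T w := hw
  obtain ⟨V, hV, hvV⟩ := hvw.exists_isPrim hT hw'.integrableOn
  have hU := isPrim_primitive u₀ hv.integrableOn
  have hUv := hU.hasWeakTimeDeriv hT
  have h0 : (0 : ℝ) ∈ Icc 0 T := ⟨le_rfl, hT.le⟩
  -- The initial condition is posed in `H¹₀`, while `V` is continuous into `H¹₀ ∩ H²`; the
  -- comparison takes place after the inclusion.
  have hV0 : toH10 (V 0) = v₀ := by
    obtain ⟨g, hg, hvg, hg0⟩ := hs.initial
    rw [← hg0]
    refine eqOn_Icc_of_ae_eq hT (continuousOn_toH10 hV.continuousOn) hg ?_ h0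
    filter_upwards [hvg, hvV] with t h1 h2
    rw [← h1, h2]
  have hmom := d.residualPath_add_eq_zero hO hT hres hV hV0 hvw hv hk hs hp
  have horth := dualL_residual_eq_zero hT (d.isPrim_residualPath hv.integrableOn hV
    hk.integrableOn) hmom (toH10 φ) hφ
  have hdU := divFree_primitive hu₀ hv.integrableOn hs.incompressible
  -- The equation for `k` and the balance for `φ` differ only in having `r''` or `ℓ(w)`. The
  -- resulting equality is integrated twice below, with the prescribed values of `r'(0)` and `r(0)`.
  have hr2 : r'' =ᵐ[volume.restrict (Ioo 0 T)] fun t => weightL μ₁ φ (w t) := by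
    filter_upwards [hs.kernel, d.weight_balance hT hv.integrableOn hV hk.integrableOn hdU
      hs.incompressible horth] with t h1 h2
    rw [eq_inv_mul_iff_mul_eq₀ hα] at h1
    linarith
  have hr1 : r' =ᵐ[volume.restrict (Ioo 0 T)] fun t => weightL μ₁ φ (V t) := by
    refine hrr''.ae_eq_of_isPrim hT (hV.clm (weightL μ₁ φ)) hr2 ?_
    -- Orthogonality of `S(0)` to `φ` expresses `ℓ(V(0))` through `u₀` alone, matching the
    -- compatibility condition on `r'(0)`.
    rw [d.weightL_initial (μ₀ := μ₀) (u₀ := u₀) (by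
      rw [← d.residualPath_zero V v k]
      exact horth h0)]
    exact hr'0
  have hr : r =ᵐ[volume.restrict (Ioo 0 T)] fun t => weightL μ₁ φ (primitive u₀ v t) := by
    refine hrr'.ae_eq_of_isPrim hT (hU.clm (weightL μ₁ φ)) ?_ ?_
    · filter_upwards [hr1, hvV] with t h1 h2
      rw [h1, h2]
    · rw [primitive_zero, ← pairing_weight]
      exact hr0
  refine ⟨⟨hU.memL2Time, v, hUv, hv1⟩, ⟨hs.pressure_mem, ⟨v, hUv, ?_⟩, ?_, ?_, ?_⟩, hUv⟩
  · filter_upwards [hmom, hvV] with t h1 h2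
    rw [h2]
    exact (d.residual_add_eq_zero_iff _ _ _ _).1 h1
  · exact (ae_restrict_iff' measurableSet_Ioo).2 (Filter.Eventually.of_forall fun t ht =>
      hdU t (Ioo_subset_Icc_self ht))
  · exact ⟨_, hU.continuousOn, Filter.EventuallyEq.rfl, primitive_zero u₀ v⟩
  · filter_upwards [hr] with t ht
    rw [pairing_weight, ht]

end ConvectiveTerm

end KelvinVoigt

end

theorem theorem3p1
    (O : Set E3) (hO : IsOpen O) (hOb : Bornology.IsBounded O)
    (T μ₀ μ₁ : ℝ) (hT : 0 < T) (hμ₀ : 0 < μ₀) (hμ₁ : 0 < μ₁)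
    (u₀ φ : H2H10 O) (p₀ : H1 O ℝ) (v₀ : H10 O E3) (r r' r'' : ℝ → ℝ)
    -- the initial velocity is divergence free
    (hu₀ : DivFree (jac u₀))
    -- the weight is divergence free
    (hφ : DivFree (jac φ))
    -- solvability for the kernel
    (hα : pairing O (vel φ) (lap u₀) ≠ 0)
    -- `v₀` is divergence free; the equation defining `v₀` is stated below for each system
    (hv₀ : DivFree v₀.1.2)
    -- `r ∈ H²(0,T)` and the value of `r(0)`; the value of `r'(0)` is stated below for each system
    (hr : MemL2Time T r) (hr' : MemL2Time T r') (hr'' : MemL2Time T r'')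
    (hrr' : HasWeakTimeDeriv T r r') (hrr'' : HasWeakTimeDeriv T r' r'')
    (hr0 : HasInitialValue T r (pairing O (fun x => vel φ x - μ₁ • lap φ x) (vel u₀))) :
    -- the Kelvin–Voigt system
    (IsResolvent μ₁ v₀ (fun x => μ₀ • lap u₀ x - kvTerm u₀ x - gradVec p₀ x) →
      HasInitialValue T r' (pairing O (fun x => μ₀ • lap u₀ x - kvTerm u₀ x) (vel φ)) →
        -- from `(u, k)` to `(∂ₜu, k)`
        (∀ (u v : ℝ → H2H10 O) (k : ℝ → ℝ) (p : ℝ → H1 O ℝ),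
          MemHTime T 2 u → MemL2Time T k → SolvesInverse kvTerm T μ₀ μ₁ u₀ φ r u k p →
          HasWeakTimeDeriv T u v →
            MemHTime T 1 v ∧
            SolvesDifferentiated kvTermDeriv (kvKernelTerm φ) T μ₀ μ₁ u₀ φ v₀ r'' v k p ∧
            HasInitialPressure T p p₀ ∧
            u =ᵐ[MeasureTheory.volume.restrict (Set.Ioo 0 T)] primitive u₀ v) ∧
        -- from `(v, k)` to `(u₀ + ∫₀ᵗ v, k)`
        (∀ (v : ℝ → H2H10 O) (k : ℝ → ℝ) (p : ℝ → H1 O ℝ),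
          MemHTime T 1 v → MemL2Time T k →
          SolvesDifferentiated kvTermDeriv (kvKernelTerm φ) T μ₀ μ₁ u₀ φ v₀ r'' v k p →
          HasInitialPressure T p p₀ →
            MemHTime T 2 (primitive u₀ v) ∧
            SolvesInverse kvTerm T μ₀ μ₁ u₀ φ r (primitive u₀ v) k p ∧
            HasWeakTimeDeriv T (primitive u₀ v) v)) ∧
    -- the Oseen type system
    (∀ U : H2H10 O, DivFree (jac U) →
      (IsResolvent μ₁ v₀ (fun x => μ₀ • lap u₀ x - oseenTerm U u₀ x - gradVec p₀ x) →
        HasInitialValue T r' (pairing O (fun x => μ₀ • lap u₀ x - oseenTerm U u₀ x) (vel φ)) →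
          -- from `(u, k)` to `(∂ₜu, k)`
          (∀ (u v : ℝ → H2H10 O) (k : ℝ → ℝ) (p : ℝ → H1 O ℝ),
            MemHTime T 2 u → MemL2Time T k → SolvesInverse (oseenTerm U) T μ₀ μ₁ u₀ φ r u k p →
            HasWeakTimeDeriv T u v →
              MemHTime T 1 v ∧
              SolvesDifferentiated (oseenTermDeriv U) (oseenKernelTerm U φ) T μ₀ μ₁ u₀ φ v₀ r'' v k p ∧
              HasInitialPressure T p p₀ ∧
              u =ᵐ[MeasureTheory.volume.restrict (Set.Ioo 0 T)] primitive u₀ v) ∧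
          -- from `(v, k)` to `(u₀ + ∫₀ᵗ v, k)`
          (∀ (v : ℝ → H2H10 O) (k : ℝ → ℝ) (p : ℝ → H1 O ℝ),
            MemHTime T 1 v → MemL2Time T k →
            SolvesDifferentiated (oseenTermDeriv U) (oseenKernelTerm U φ) T μ₀ μ₁ u₀ φ v₀ r'' v k p →
            HasInitialPressure T p p₀ →
              MemHTime T 2 (primitive u₀ v) ∧
              SolvesInverse (oseenTerm U) T μ₀ μ₁ u₀ φ r (primitive u₀ v) k p ∧
              HasWeakTimeDeriv T (primitive u₀ v) v))) := by
  have : Fact (Bornology.IsBounded O) := ⟨hOb⟩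
  refine ⟨fun hres hr'0 => ⟨fun u v k p hu hk hs huv => ?_, fun v k p hv hk hs hp => ?_⟩,
    fun U hU hres hr'0 => ⟨fun u v k p hu hk hs huv => ?_, fun v k p hv hk hs hp => ?_⟩⟩
  · exact (kvConvectiveTerm φ).solvesDifferentiated hT hμ₁ hφ hα hv₀ hrr' hrr'' hres hu hk hs huv
  · exact (kvConvectiveTerm φ).solvesInverse hO hT hu₀ hφ hα hrr' hrr'' hr0 hres hr'0 hv hk hs hp
  · exact (oseenConvectiveTerm φ U hU).solvesDifferentiated hT hμ₁ hφ hα hv₀ hrr' hrr'' hres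
      hu hk hs huv
  · exact (oseenConvectiveTerm φ U hU).solvesInverse hO hT hu₀ hφ hα hrr' hrr'' hr0 hres hr'0
      hv hk hs hp
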